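/- **Setting.** A decentralized finite-sum variational inequality on $\mathbb R^d$ with $M$ workers consists of operators $F_{m,i}:\mathbb R^d\to\mathbb R^d$ ($1\le m\le M$, $1\le i\le n$) and a proper lower semicontinuous convex function $g:\mathbb R^d\to\mathbb R\cup\{+\infty\}$. Put $F_m=\frac1n\sum_{i=1}^nF_{m,i}$ and $F=\sum_{m=1}^MF_m$. A solution is a point $z^*$ with $\langle F(z^*),z-z^*\rangle+g(z)-g(z^*)\ge0$ for all $z$. The instance is called $(L,\overline L)$-Lipschitz if every $F_m$ is $L$-Lipschitz and $\frac1n\sum_i\|F_{m,i}(u)-F_{m,i}(v)\|^2\le\overline L^2\|u-v\|^2$ for all $m,u,v$. An operator $T$ is $\nu$-strongly monotone if $\langle T(u)-T(v),u-v\rangle\ge\nu\|u-v\|^2$ for all $u,v$. A fixed network with characteristic number $\chi$ is a connected undirected graph on the $M$ workers together with a symmetric positive semidefinite $M\times M$ matrix $\mathbf W$ whose kernel is the set of constant vectors, with $w_{ij}\ne0$ if and only if $i=j$ or $ij$ is an edge, with $\lambda_{\max}(\mathbf W)=1$ and smallest positive eigenvalue $1/\chi$. A procedure starts with local memories $\mathcal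 M_m=\{0\}$. In each iteration it either communicates or performs local computations, and this choice and the batch sizes may depend on the past and on internal randomness. In a local iteration each device $m$ may sample, uniformly and independently of the past and of the other devices, a subset $S_m$ of any size $b$ of $\{F_{m,1},\dots,F_{m,n}\}$, which costs $b$ local computations, and adds to $\mathcal M_m$ finitely many points of the span of all $z'$, $\sum_{i\in S_m}F_{m,i}(z'')$ and $\mathrm{prox}_{\rho g}(u)$, where $z',z''\in\mathcal M_m$, $\rho>0$ and $u\in\mathrm{span}\{z''',\ \sum_{i\in S_m}F_{m,i}(z'') : z'',z'''\in\mathcal M_m\}$. In a communication round each $\mathcal M_m$ is replaced by the span of the union of $\mathcal M_m$ and the memories of the neighbours of $m$. The output $\hat z$ is any point of the span of all memories. It is an $\varepsilon$-solution in expectation if $\mathbb E\|\hat z-z^*\|^2\le\varepsilon$. Write $z^0=0$ and $R_0=\|z^0-z^*\|$. **Statement.** Let $L=\overline L/\sqrt n$. (1) For every $\kappa>1$ there are constants $c,\delta>0$, depending only on $\kappa$, such that for all $n\ge1$, $\mu>0$, $\overline L$ with $L\ge\kappa\mu$, $\chi\ge1$, $R_0>0$, $0<\varepsilon\le\delta R_0^2$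 and all sufficiently large $d$ the following holds. (1a) There is an $(L,\overline L)$-Lipschitz decentralized variational inequality on $\mathbb R^d$, with every $F_m$ $\mu$-strongly monotone, over a fixed network with characteristic number $\chi$, having a solution $z^*\ne0$ with $\|z^0-z^*\|=R_0$, such that every procedure that outputs an $\varepsilon$-solution in expectation with at most $K$ communication rounds and at most $N$ local computations in total over all devices satisfies $$K\ \ge\ c\,\sqrt\chi\Big(1+\frac L\mu\Big)\log\frac{R_0^2}\varepsilon\qquad\text{and}\qquad N\ \ge\ c\Big(n+\sqrt n\,\frac{\overline L}\mu\Big)\log\frac{R_0^2}\varepsilon .$$ (1b) There is also an instance with the same properties for which $N\ge c\,(n+\sqrt n\,\overline L/\mu)\log(R_0^2/\varepsilon)$ holds even if $N$ only bounds the number of local computations of each single device (with any number of communication rounds). (2) There are absolute constants $c,\delta>0$ such that for all $n\ge1$, $\mu>0$, $\overline L$ with $L\ge\mu$, $\chi\ge1$, $R_0>0$, $0<\varepsilon\le\delta R_0^2$ and all sufficiently large $d$ there is an $(L,\overline L)$-Lipschitz decentralized variational inequality on $\mathbb R^d$, with $F$ $\mu$-strongly monotone and every $F_m$ $(\mu/M)$-strongly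 monotone, over a fixed network with characteristic number $\chi$, having a solution $z^*\ne0$ with $\|z^0-z^*\|=R_0$, such that every procedure that outputs an $\varepsilon$-solution in expectation with at most $K$ communication rounds and at most $N$ local computations on each device satisfies both displayed inequalities of (1a). -/

import Mathlib

open MeasureTheory
open scoped ENNReal

noncomputable section

namespace DecVI

/-- `ℝ^d` with the Euclidean inner product and norm. -/
abbrev Vec (d : ℕ) : Type := EuclideanSpace ℝ (Fin d)

/-- `ν`-strong monotonicity of an operator. -/
def StronglyMonotone {d : ℕ} (T : Vec d → Vec d) (ν : ℝ) : Prop :=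
  ∀ u v : Vec d, ν * ‖u - v‖ ^ 2 ≤ inner ℝ (T u - T v) (u - v)

/-- `L`-Lipschitz continuity of an operator. -/
def LipschitzOp {d : ℕ} (T : Vec d → Vec d) (L : ℝ) : Prop :=
  ∀ u v : Vec d, ‖T u - T v‖ ≤ L * ‖u - v‖

/-- The data of a decentralized finite-sum variational inequality on `ℝ^d` with `M` workers, each of
which holds `n` component operators: the operators `F_{m,i}` and a proper lower semicontinuous
convex function `g : ℝ^d → ℝ ∪ {+∞}`. -/
structure Problem (M n d : ℕ) where
  /-- the component operator `F_{m,i}` -/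
  comp : Fin M → Fin n → Vec d → Vec d
  /-- the regularizer `g` -/
  g : Vec d → EReal
  g_ne_bot : ∀ z, g z ≠ ⊥
  g_proper : ∃ z, g z ≠ ⊤
  g_lsc : LowerSemicontinuous g
  /-- convexity of `g`, expressed by convexity of its epigraph -/
  g_convex : Convex ℝ {p : Vec d × ℝ | g p.1 ≤ (p.2 : EReal)}

namespace Problem

variable {M n d : ℕ}

/-- The local operator `F_m = (1/n) ∑ᵢ F_{m,i}` of worker `m`. -/
def localOp (Q : Problem M n d) (m : Fin M) (z : Vec d) : Vec d :=
  (1 / (n : ℝ)) • ∑ i, Q.comp m i z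

/-- The global operator `F = ∑ₘ F_m`. -/
def op (Q : Problem M n d) (z : Vec d) : Vec d := ∑ m, Q.localOp m z

/-- `zs` solves the variational inequality: `⟨F(zs), z - zs⟩ + g(z) - g(zs) ≥ 0` for all `z`
(written without subtraction of extended reals; since `g` is proper this forces `g zs < ∞`). -/
def IsSolution (Q : Problem M n d) (zs : Vec d) : Prop :=
  ∀ z : Vec d, Q.g zs ≤ ((inner ℝ (Q.op zs) (z - zs) : ℝ) : EReal) + Q.g z

/-- Each `F_m` is `L`-Lipschitz, and for each `m` the collection `F_{m,1}, …, F_{m,n}` is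
`Lbar`-average Lipschitz. -/
def IsLipschitz (Q : Problem M n d) (L Lbar : ℝ) : Prop :=
  (∀ m, LipschitzOp (Q.localOp m) L) ∧
  ∀ m, ∀ u v : Vec d,
    (1 / (n : ℝ)) * ∑ i, ‖Q.comp m i u - Q.comp m i v‖ ^ 2 ≤ Lbar ^ 2 * ‖u - v‖ ^ 2

/-- `p = prox_{ρ g}(u)`, i.e. `p` minimizes `ρ g(y) + ½ ‖y - u‖²` over `y`. -/
def IsProx (Q : Problem M n d) (ρ : ℝ) (u p : Vec d) : Prop :=
  ∀ y : Vec d, (ρ : EReal) * Q.g p + ((‖p - u‖ ^ 2 / 2 : ℝ) : EReal)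
    ≤ (ρ : EReal) * Q.g y + ((‖y - u‖ ^ 2 / 2 : ℝ) : EReal)

/-- The sampled operator `z ↦ ∑_{i ∈ S} F_{m,i}(z)`. -/
def batchOp (Q : Problem M n d) (m : Fin M) (S : Finset (Fin n)) (z : Vec d) : Vec d :=
  ∑ i ∈ S, Q.comp m i z

/-- The span of the points `z'''` and `∑_{i ∈ S} F_{m,i}(z'')`, with `z'', z'''` in the memory. -/
def gradSpan (Q : Problem M n d) (m : Fin M) (S : Finset (Fin n)) (mem : Set (Vec d)) :
    Submodule ℝ (Vec d) :=
  Submodule.span ℝ (mem ∪ Q.batchOp m S '' mem)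

/-- The points that device `m` may add to its memory in one local iteration with batch `S`: the span
of `z'`, `∑_{i ∈ S} F_{m,i}(z'')` and `prox_{ρ g}(span{z''', ∑_{i ∈ S} F_{m,i}(z'')})`, where
`z', z'', z'''` range over the memory and `ρ` over the positive numbers. -/
def reachable (Q : Problem M n d) (m : Fin M) (S : Finset (Fin n)) (mem : Set (Vec d)) :
    Submodule ℝ (Vec d) :=
  Submodule.span ℝ (mem ∪ Q.batchOp m S '' mem ∪
    {p | ∃ ρ : ℝ, 0 < ρ ∧ ∃ u ∈ Q.gradSpan m S mem, Q.IsProx ρ u p})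

end Problem

/-- A fixed network: `G` is a connected undirected graph on the workers and `W` is a gossip matrix
for it, with `λ_max(W) = 1` and characteristic number `χ = λ_max(W) / λ⁺_min(W) = 1 / λ⁺_min(W)`. -/
structure IsFixedNetwork {M : ℕ} (G : SimpleGraph (Fin M)) (W : Matrix (Fin M) (Fin M) ℝ)
    (χ : ℝ) : Prop where
  connected : G.Connected
  /-- `W` is symmetric positive semidefinite -/
  posSemidef : W.PosSemidef
  /-- the kernel of `W` is the consensus space -/
  ker_iff : ∀ v : Fin M → ℝ, W.mulVec v = 0 ↔ ∃ a : ℝ, v = fun _ => a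
  /-- `W` is supported on the vertices and edges of the network only -/
  support : ∀ i j, W i j ≠ 0 ↔ i = j ∨ G.Adj i j
  /-- the largest eigenvalue is `1` -/
  eig_max : IsGreatest {lam : ℝ | Module.End.HasEigenvalue (Matrix.toLin' W) lam} 1
  /-- the smallest positive eigenvalue is `1 / χ` -/
  eig_min : IsLeast {lam : ℝ | 0 < lam ∧ Module.End.HasEigenvalue (Matrix.toLin' W) lam} (1 / χ)

/-- A (randomized, adaptive) procedure for the problem `Q` over the network `G`. Iterations are
numbered `0, …, T - 1`. The σ-algebra `ℱ t` is what the procedure may use when it decides the type of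
iteration `t` and the batch sizes; it may contain randomness of the procedure itself. -/
structure Procedure {M n d : ℕ} (Q : Problem M n d) (G : SimpleGraph (Fin M))
    {Ω : Type} [mΩ : MeasurableSpace Ω] (P : Measure Ω) where
  /-- number of iterations -/
  T : ℕ
  /-- the information available before each iteration -/
  ℱ : Filtration ℕ mΩ
  /-- whether iteration `t` is a communication round (otherwise it is a local iteration) -/
  isComm : ℕ → Ω → Bool
  /-- the size of the batch sampled by device `m` in iteration `t` -/
  size : ℕ → Fin M → Ω → ℕ
  /-- the batch sampled by device `m` in iteration `t` -/
  batch : ℕ → Fin M → Ω → Finset (Fin n)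
  /-- the local memory of device `m` before iteration `t` -/
  mem : ℕ → Fin M → Ω → Set (Vec d)
  /-- the final global output -/
  out : Ω → Vec d
  measurable_isComm : ∀ t, Measurable[ℱ t] (isComm t)
  measurable_size : ∀ t m, Measurable[ℱ t] (size t m)
  measurable_batch : ∀ t m s, MeasurableSet[ℱ (t + 1)] {ω | batch t m ω = s}
  measurable_out : Measurable out
  /-- nothing is sampled in a communication round -/
  size_of_comm : ∀ t m ω, isComm t ω = true → size t m ω = 0
  /-- conditionally on the past, the batches of the devices are independent, and that of device `m`
  is uniform among the subsets of `{F_{m,1}, …, F_{m,n}}` of the chosen size -/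
  law_batch : ∀ t, ∀ A : Set Ω, MeasurableSet[ℱ t] A → ∀ s : Fin M → Finset (Fin n),
    P (A ∩ {ω | ∀ m, batch t m ω = s m}) =
      ∫⁻ ω in A, ∏ m, (if (s m).card = size t m ω
        then ((n.choose (size t m ω) : ℕ) : ℝ≥0∞)⁻¹ else 0) ∂P
  /-- the memories are initialized with `{0}` -/
  mem_zero : ∀ m ω, mem 0 m ω = {0}
  /-- local iteration: each device adds finitely many reachable points to its memory -/
  mem_local : ∀ t m ω, t < T → isComm t ω = false →
    ∃ A : Set (Vec d), A.Finite ∧ A ⊆ Q.reachable m (batch t m ω) (mem t m ω) ∧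
      mem (t + 1) m ω = mem t m ω ∪ A
  /-- communication round: the new memory is the span of the device's own memory and of those of its
  neighbours -/
  mem_comm : ∀ t m ω, t < T → isComm t ω = true →
    mem (t + 1) m ω =
      (Submodule.span ℝ (⋃ i ∈ {i | i = m ∨ G.Adj i m}, mem t i ω) : Set (Vec d))
  /-- the output lies in the span of all the memories -/
  out_mem : ∀ ω, out ω ∈ Submodule.span ℝ (⋃ m, mem T m ω)

namespace Procedure

variable {M n d : ℕ} {Q : Problem M n d} {G : SimpleGraph (Fin M)}
  {Ω : Type} [MeasurableSpace Ω] {P : Measure Ω}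

/-- The number of communication rounds. -/
def rounds (A : Procedure Q G P) (ω : Ω) : ℕ :=
  ∑ t ∈ Finset.range A.T, if A.isComm t ω = true then 1 else 0

/-- The number of local computations of device `m`: a call with a batch of size `b` costs `b`. -/
def calls (A : Procedure Q G P) (m : Fin M) (ω : Ω) : ℕ :=
  ∑ t ∈ Finset.range A.T, A.size t m ω

/-- The output is an `ε`-solution in expectation: `E ‖out - zs‖² ≤ ε`. -/
def IsEpsSolution (A : Procedure Q G P) (zs : Vec d) (ε : ℝ) : Prop :=
  ∫⁻ ω, ENNReal.ofReal (‖A.out ω - zs‖ ^ 2) ∂P ≤ ENNReal.ofReal ε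

end Procedure

/-- Some procedure with at most `K` communication rounds and at most `N` local computations
altogether (summed over all devices) outputs an `ε`-solution in expectation. -/
def SolvableTotal {M n d : ℕ} (Q : Problem M n d) (G : SimpleGraph (Fin M)) (zs : Vec d)
    (K N : ℕ) (ε : ℝ) : Prop :=
  ∃ (Ω : Type) (_ : MeasurableSpace Ω) (P : Measure Ω) (_ : IsProbabilityMeasure P)
    (A : Procedure Q G P),
    (∀ᵐ ω ∂P, A.rounds ω ≤ K) ∧ (∀ᵐ ω ∂P, ∑ m, A.calls m ω ≤ N) ∧ A.IsEpsSolution zs ε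

/-- Some procedure with at most `K` communication rounds and at most `N` local computations on each
device outputs an `ε`-solution in expectation. -/
def SolvablePerDevice {M n d : ℕ} (Q : Problem M n d) (G : SimpleGraph (Fin M)) (zs : Vec d)
    (K N : ℕ) (ε : ℝ) : Prop :=
  ∃ (Ω : Type) (_ : MeasurableSpace Ω) (P : Measure Ω) (_ : IsProbabilityMeasure P)
    (A : Procedure Q G P),
    (∀ᵐ ω ∂P, A.rounds ω ≤ K) ∧ (∀ᵐ ω ∂P, ∀ m, A.calls m ω ≤ N) ∧ A.IsEpsSolution zs ε

end DecVI

end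

/-!
The hard operator is a chain. Let `S` be the skew-symmetric tridiagonal operator `(S z)ₖ = zₖ₊₁ -
zₖ₋₁`. The equation `a z + β S z = b e₀` has a geometric progression `C qᵏ` as its solution, where
`1 / q - q = a / β =: ρ`, so that `-log (q²) ≤ ρ`. It stays exact in finite dimension if the last
coordinate is coupled with `q` times itself (`chainProblem_isSolution`), and this extra diagonal
entry does not spoil the Lipschitz bound (`sum_link_sq_le'`). A point whose coordinates from the
`j`-th on vanish is at squared distance about `q²ʲ R₀²` from the solution, so about `log (R₀² / ε)
/ ρ` coordinates have to be discovered.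

Each discovery is expensive, for two reasons. The even links of the chain are held by a group `A`
of workers and the odd links by a group `B`, so that successive coordinates are discovered
alternately by the two groups, and between two discoveries the news has to travel from one group
to the other (`Procedure.mem_subset_arrival`). Moreover each worker keeps its whole local operator
in the first of its `n` components, which is why the averaged Lipschitz constant is `√n L`. A
discovery needs a batch with this component, and a batch of size `b` contains it with probability
`b / n` only (`Procedure.measure_mem_batch_le`); Markov's inequality bounds the number of
discoveries (`Procedure.half_le_measure_hits_lt`).

The network consists of `ℓ ≈ √χ / 4` layers of three nodes. Its gossip matrix is the Laplacian of
the path of layers, acting on the layer sums, plus on each layer two further eigenvectors with the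
prescribed eigenvalues `1` and `1 / χ`. By the discrete Poincaré inequality the path part has its
positive spectrum between these two, so the characteristic number is exactly `χ`
(`isFixedNetwork_layerGossip`). If every local operator is `μ`-strongly monotone, the global
operator is `M μ`-strongly monotone, so the groups must contain a fixed fraction of all workers to
keep its condition number of order `L / μ`: they occupy the outer thirds of the layers, at
distance of order `√χ`. If only the global operator has to be `μ`-strongly monotone, or if the
communication is not counted (one layer), a single worker in each group suffices, and then the
total and the per-device numbers of relevant computations agree up to a factor of two.
-/

/-! ### The network -/

namespace DecVI

open Matrix

/-- The graph on which a symmetric matrix is supported. -/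
def supportGraph {I : Type*} (W : Matrix I I ℝ) (hW : W.IsSymm) : SimpleGraph I where
  Adj i j := i ≠ j ∧ W i j ≠ 0
  symm := ⟨fun i j h => ⟨h.1.symm, by rw [hW.apply]; exact h.2⟩⟩
  loopless := ⟨fun _ h => h.1 rfl⟩

/-- The indicator of a connected component of the support of a matrix which annihilates constants is
annihilated as well, so if the kernel consists of the constants only, the support is connected. -/
lemma supportGraph_connected {I : Type*} [Fintype I] [Nonempty I] (W : Matrix I I ℝ)
    (hW : W.IsSymm) (hker : ∀ v : I → ℝ, W *ᵥ v = 0 ↔ ∃ a : ℝ, v = fun _ => a) :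
    (supportGraph W hW).Connected := by
  classical
  rw [SimpleGraph.connected_iff]
  refine ⟨fun x y => ?_, inferInstance⟩
  set G := supportGraph W hW
  have h0 : W *ᵥ (fun j => if G.Reachable x j then (1 : ℝ) else 0) = 0 := by
    have h1 : W *ᵥ (fun _ => (1 : ℝ)) = 0 := (hker _).2 ⟨1, rfl⟩
    ext i
    by_cases hi : G.Reachable x i
    · rw [← h1]
      refine Finset.sum_congr rfl fun j _ => ?_
      by_cases hj : G.Reachable x j
      · simp [hj]
      · have : W i j = 0 := by
          by_contra hne
          have hij : i ≠ j := by rintro rfl; exact hj hi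
          exact hj (hi.trans (SimpleGraph.Adj.reachable (G := G) ⟨hij, hne⟩))
        simp [this]
    · refine Finset.sum_eq_zero fun j _ => ?_
      by_cases hj : G.Reachable x j
      · have : W i j = 0 := by
          by_contra hne
          have hij : i ≠ j := by rintro rfl; exact hi hj
          exact hi (hj.trans (SimpleGraph.Adj.reachable (G := G) ⟨hij, hne⟩).symm)
        simp [this]
      · simp [hj]
  obtain ⟨a, ha⟩ := (hker _).1 h0
  have hx := congrFun ha x
  have hy := congrFun ha y
  simp only [SimpleGraph.Reachable.refl, if_true] at hx
  by_contra hxy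
  rw [if_neg hxy] at hy
  linarith

lemma hasEigenvalue_toLin'_iff {I : Type*} [Fintype I] [DecidableEq I] (W : Matrix I I ℝ)
    (a : ℝ) : Module.End.HasEigenvalue (Matrix.toLin' W) a ↔ ∃ v ≠ 0, W *ᵥ v = a • v := by
  constructor
  · intro h
    obtain ⟨v, hv⟩ := h.exists_hasEigenvector
    exact ⟨v, hv.2, by simpa using hv.apply_eq_smul⟩
  · rintro ⟨v, hv, h⟩
    exact Module.End.hasEigenvalue_of_hasEigenvector
      (x := v) ⟨by simpa [Module.End.mem_eigenspace_iff] using h, hv⟩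

/-- Bounds of the quadratic form of `W` and two eigenvectors suffice to recognize a gossip matrix
with characteristic number `χ`. -/
lemma isFixedNetwork_supportGraph {M : ℕ} [Nonempty (Fin M)] (W : Matrix (Fin M) (Fin M) ℝ) {χ : ℝ}
    (hχ : 0 < χ) (hW : W.IsSymm)
    (hker : ∀ v : Fin M → ℝ, W *ᵥ v = 0 ↔ ∃ a : ℝ, v = fun _ => a)
    (hdiag : ∀ i, W i i ≠ 0)
    (hpos : ∀ v, 0 ≤ v ⬝ᵥ W *ᵥ v)
    (hle : ∀ v, v ⬝ᵥ W *ᵥ v ≤ v ⬝ᵥ v)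
    (hge : ∀ v, ∑ i, v i = 0 → 1 / χ * (v ⬝ᵥ v) ≤ v ⬝ᵥ W *ᵥ v)
    (hmax : ∃ v ≠ 0, W *ᵥ v = (1 : ℝ) • v) (hmin : ∃ v ≠ 0, W *ᵥ v = (1 / χ) • v) :
    IsFixedNetwork (supportGraph W hW) W χ where
  connected := supportGraph_connected W hW hker
  posSemidef := PosSemidef.of_dotProduct_mulVec_nonneg
    (by rw [IsHermitian, conjTranspose_eq_transpose_of_trivial]; exact hW) (by simpa using hpos)
  ker_iff := hker
  support i j := by
    by_cases h : i = j
    · subst h; simpa using hdiag i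
    · simp [supportGraph, h]
  eig_max := by
    refine ⟨(hasEigenvalue_toLin'_iff _ _).2 hmax, fun a ha => ?_⟩
    obtain ⟨v, hv, h⟩ := (hasEigenvalue_toLin'_iff _ _).1 ha
    have h1 := hle v
    rw [h, dotProduct_smul, smul_eq_mul] at h1
    have h2 : 0 < v ⬝ᵥ v := by simpa using dotProduct_star_self_pos_iff.2 hv
    nlinarith
  eig_min := by
    refine ⟨⟨by positivity, (hasEigenvalue_toLin'_iff _ _).2 hmin⟩, fun a ⟨ha0, ha⟩ => ?_⟩
    obtain ⟨v, hv, h⟩ := (hasEigenvalue_toLin'_iff _ _).1 ha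
    have h2 : 0 < v ⬝ᵥ v := by simpa using dotProduct_star_self_pos_iff.2 hv
    have h3 : ∑ i, v i = 0 := by
      have h4 : (fun _ => (1 : ℝ)) ⬝ᵥ W *ᵥ v = 0 := by
        rw [dotProduct_mulVec, ← mulVec_transpose, hW.eq, (hker _).2 ⟨1, rfl⟩, zero_dotProduct]
      rw [h, dotProduct_smul, smul_eq_mul] at h4
      have := (mul_eq_zero.1 h4).resolve_left ha0.ne'
      simpa [dotProduct] using this
    have h1 := hge v h3
    rw [h, dotProduct_smul, smul_eq_mul] at h1
    exact le_of_mul_le_mul_right h1 h2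

lemma sum_sq_sub_le (a : ℕ → ℝ) (m : ℕ) :
    ∑ k ∈ Finset.range m, (a k - a (k + 1)) ^ 2 ≤ 4 * ∑ k ∈ Finset.range (m + 1), a k ^ 2 := by
  have h : ∑ k ∈ Finset.range m, (a k - a (k + 1)) ^ 2
      ≤ 4 * ∑ k ∈ Finset.range m, a k ^ 2 + 2 * a m ^ 2 := by
    induction m with
    | zero => simp; positivity
    | succ m ih =>
      rw [Finset.sum_range_succ, Finset.sum_range_succ]
      nlinarith [sq_nonneg (a m + a (m + 1))]
  rw [Finset.sum_range_succ]
  nlinarith [sq_nonneg (a m)]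

/-- The discrete Poincaré inequality on a path, with a constant that is optimal up to a factor. -/
lemma sum_sq_le_of_sum_eq_zero (a : ℕ → ℝ) (m : ℕ)
    (ha : ∑ k ∈ Finset.range (m + 1), a k = 0) :
    ∑ k ∈ Finset.range (m + 1), a k ^ 2 ≤
      (m + 1 : ℝ) ^ 2 * ∑ k ∈ Finset.range m, (a k - a (k + 1)) ^ 2 := by
  set D := ∑ k ∈ Finset.range m, (a k - a (k + 1)) ^ 2 with hD
  have hD0 : 0 ≤ D := Finset.sum_nonneg fun _ _ => sq_nonneg _
  have key : ∀ i j, i ≤ j → j ≤ m → (a i - a j) ^ 2 ≤ (m + 1 : ℝ) * D := by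
    intro i j hij hj
    have h1 : a i - a j = ∑ k ∈ Finset.Ico i j, (a k - a (k + 1)) := by
      have := Finset.sum_Ico_sub a hij
      rw [← neg_inj, neg_sub, ← this, ← Finset.sum_neg_distrib]
      simp
    rw [h1]
    refine sq_sum_le_card_mul_sum_sq.trans ?_
    have h2 : ∑ k ∈ Finset.Ico i j, (a k - a (k + 1)) ^ 2 ≤ D :=
      Finset.sum_le_sum_of_subset_of_nonneg
        (fun k hk => by simp only [Finset.mem_Ico, Finset.mem_range] at *; omega)
        (fun _ _ _ => sq_nonneg _)
    have h3 : ((Finset.Ico i j).card : ℝ) ≤ m + 1 := by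
      rw [Nat.card_Ico]; exact_mod_cast (by omega : j - i ≤ m + 1)
    have h4 : 0 ≤ ∑ k ∈ Finset.Ico i j, (a k - a (k + 1)) ^ 2 :=
      Finset.sum_nonneg fun _ _ => sq_nonneg _
    exact mul_le_mul h3 h2 h4 (by positivity)
  have key' : ∀ i ≤ m, a i ^ 2 ≤ (m + 1 : ℝ) * D := by
    intro i hi
    have h1 : ∑ j ∈ Finset.range (m + 1), (a i - a j) ^ 2
        ≤ ∑ j ∈ Finset.range (m + 1), (m + 1 : ℝ) * D := by
      refine Finset.sum_le_sum fun j hj => ?_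
      rw [Finset.mem_range] at hj
      rcases le_total i j with h | h
      · exact key i j h (by omega)
      · rw [← neg_sub, neg_sq]; exact key j i h hi
    have h2 : ∑ j ∈ Finset.range (m + 1), (a i - a j) ^ 2
        = (m + 1 : ℝ) * a i ^ 2 + ∑ j ∈ Finset.range (m + 1), a j ^ 2 := by
      have : ∀ j, (a i - a j) ^ 2 = a i ^ 2 - 2 * a i * a j + a j ^ 2 := fun j => by ring
      simp_rw [this, Finset.sum_add_distrib, Finset.sum_sub_distrib, ← Finset.mul_sum, ha]
      simp
    have h3 : 0 ≤ ∑ j ∈ Finset.range (m + 1), a j ^ 2 := Finset.sum_nonneg fun _ _ => sq_nonneg _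
    rw [Finset.sum_const, Finset.card_range, nsmul_eq_mul] at h1
    push_cast at h1
    have h4 : (0 : ℝ) < m + 1 := by positivity
    refine le_of_mul_le_mul_left ?_ h4
    linarith
  calc ∑ k ∈ Finset.range (m + 1), a k ^ 2
      ≤ ∑ k ∈ Finset.range (m + 1), (m + 1 : ℝ) * D :=
        Finset.sum_le_sum fun k hk => key' k (by rw [Finset.mem_range] at hk; omega)
    _ = _ := by rw [Finset.sum_const, Finset.card_range, nsmul_eq_mul]; push_cast; ring

/-- A square root `R` of the gossip matrix `W = Rᵀ R` of the layered network. The nodes are the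
pairs `(k, s)` of a layer `k` (out of `p + 1`) and a position `s` (out of three); the rows are
indexed in the same way: `(k, 0)` compares the sums over layers `k` and `k + 1`, while `(k, 1)`
and `(k, 2)` complete the constants to an orthogonal basis of the functions on layer `k`, scaled
so that they become eigenvectors with eigenvalues `1` and `1 / χ`. -/
noncomputable def layerRoot (p : ℕ) (χ : ℝ) :
    Matrix (Fin (p + 1) × Fin 3) (Fin (p + 1) × Fin 3) ℝ :=
  fun a b => ![(if a.1 = b.1 ∧ (a.1 : ℕ) < p then √(1 / 12) else 0) -
      (if (a.1 : ℕ) + 1 = b.1 then √(1 / 12) else 0),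
    if a.1 = b.1 then (1 / √2) * ![1, -1, 0] b.2 else 0,
    if a.1 = b.1 then (1 / √(6 * χ)) * ![1, 1, -2] b.2 else 0] a.2

/-- The sum of `w` over layer `k`. -/
noncomputable def layerSum {p : ℕ} (w : Fin (p + 1) × Fin 3 → ℝ) (k : ℕ) : ℝ :=
  if h : k < p + 1 then ∑ s, w (⟨k, h⟩, s) else 0

variable {p : ℕ} {χ : ℝ}

lemma layerRoot_mulVec_zero (w : Fin (p + 1) × Fin 3 → ℝ) (k : Fin (p + 1)) :
    (layerRoot p χ *ᵥ w) (k, 0) =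
      if (k : ℕ) < p then √(1 / 12) * (layerSum w k - layerSum w (k + 1)) else 0 := by
  simp only [mulVec, dotProduct, Fintype.sum_prod_type, layerRoot, Fin.sum_univ_three,
    Matrix.cons_val_zero, sub_mul]
  split_ifs with h
  · have h1 : ∀ x : Fin (p + 1), ((k : ℕ) + 1 = x) ↔ x = ⟨k + 1, by omega⟩ := fun x => by
      rw [Fin.ext_iff]; exact eq_comm
    rw [layerSum, layerSum, dif_pos k.2, dif_pos (by omega : (k : ℕ) + 1 < p + 1)]
    simp only [h, and_true, h1, ite_mul, zero_mul, Finset.sum_ite_eq, Finset.sum_ite_eq',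
      Finset.mem_univ, if_true, Finset.sum_add_distrib, Finset.sum_sub_distrib,
      Fin.sum_univ_three, Fin.eta]
    generalize w (⟨k + 1, _⟩, _) = x0
    generalize w (⟨k + 1, _⟩, _) = x1
    generalize w (⟨k + 1, _⟩, _) = x2
    ring
  · have h1 : ∀ x : Fin (p + 1), ¬ ((k : ℕ) + 1 = x) := fun x => by omega
    simp [h, h1]

lemma layerRoot_mulVec_one (w : Fin (p + 1) × Fin 3 → ℝ) (k : Fin (p + 1)) :
    (layerRoot p χ *ᵥ w) (k, 1) = 1 / √2 * (w (k, 0) - w (k, 1)) := by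
  simp only [mulVec, dotProduct, Fintype.sum_prod_type, layerRoot, Fin.sum_univ_three]
  simp [Finset.sum_add_distrib]
  ring

lemma layerRoot_mulVec_two (w : Fin (p + 1) × Fin 3 → ℝ) (k : Fin (p + 1)) :
    (layerRoot p χ *ᵥ w) (k, 2) = 1 / √(6 * χ) * (w (k, 0) + w (k, 1) - 2 * w (k, 2)) := by
  simp only [mulVec, dotProduct, Fintype.sum_prod_type, layerRoot, Fin.sum_univ_three]
  simp [Finset.sum_add_distrib]
  ring

lemma layerSum_fin (w : Fin (p + 1) × Fin 3 → ℝ) (k : Fin (p + 1)) :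
    layerSum w k = w (k, 0) + w (k, 1) + w (k, 2) := by
  rw [layerSum, dif_pos k.2, Fin.sum_univ_three]

lemma sum_layerSum (w : Fin (p + 1) × Fin 3 → ℝ) :
    ∑ k ∈ Finset.range (p + 1), layerSum w k = ∑ a, w a := by
  rw [← Fin.sum_univ_eq_sum_range, Fintype.sum_prod_type]
  exact Finset.sum_congr rfl fun k _ => by rw [layerSum_fin, Fin.sum_univ_three]

/-- The quadratic form of the gossip matrix. -/
lemma sum_sq_layerRoot_mulVec (hχ : 0 < χ) (w : Fin (p + 1) × Fin 3 → ℝ) :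
    ∑ a, (layerRoot p χ *ᵥ w) a ^ 2 =
      1 / 12 * ∑ k ∈ Finset.range p, (layerSum w k - layerSum w (k + 1)) ^ 2 +
      ∑ k, ((w (k, 0) - w (k, 1)) ^ 2 / 2 +
        (1 / χ) * ((w (k, 0) + w (k, 1) - 2 * w (k, 2)) ^ 2 / 6)) := by
  have h1 : √(1 / 12 : ℝ) ^ 2 = 1 / 12 := Real.sq_sqrt (by norm_num)
  have h2 : √(2 : ℝ) ^ 2 = 2 := Real.sq_sqrt (by norm_num)
  have h3 : √(6 * χ) ^ 2 = 6 * χ := Real.sq_sqrt (by positivity)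
  rw [Fintype.sum_prod_type]
  simp_rw [Fin.sum_univ_three, layerRoot_mulVec_zero, layerRoot_mulVec_one, layerRoot_mulVec_two,
    add_assoc, Finset.sum_add_distrib (f := fun k : Fin (p + 1) =>
      (if (k : ℕ) < p then √(1 / 12) * (layerSum w k - layerSum w (k + 1)) else 0) ^ 2)]
  congr 1
  · rw [Fin.sum_univ_eq_sum_range (fun k =>
      (if k < p then √(1 / 12) * (layerSum w k - layerSum w (k + 1)) else 0) ^ 2),
      Finset.sum_range_succ, Finset.mul_sum]
    simp only [lt_irrefl, if_false, ne_eq, OfNat.ofNat_ne_zero, not_false_eq_true, zero_pow,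
      add_zero]
    refine Finset.sum_congr rfl fun k hk => ?_
    rw [if_pos (Finset.mem_range.1 hk), mul_pow, h1]
  · refine Finset.sum_congr rfl fun k _ => ?_
    simp only [mul_pow, div_pow, h2, h3]
    field_simp

lemma sum_sq_eq_layers (w : Fin (p + 1) × Fin 3 → ℝ) :
    ∑ a, w a ^ 2 = 1 / 3 * ∑ k ∈ Finset.range (p + 1), layerSum w k ^ 2 +
      ∑ k, ((w (k, 0) - w (k, 1)) ^ 2 / 2 + (w (k, 0) + w (k, 1) - 2 * w (k, 2)) ^ 2 / 6) := by
  rw [← Fin.sum_univ_eq_sum_range (fun k => layerSum w k ^ 2), Finset.mul_sum,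
    ← Finset.sum_add_distrib, Fintype.sum_prod_type]
  refine Finset.sum_congr rfl fun k _ => ?_
  rw [layerSum_fin, Fin.sum_univ_three]
  ring

/-- The gossip matrix of the layered network, on the nodes `0, …, 3 (p + 1) - 1`. -/
noncomputable def layerGossip (p : ℕ) (χ : ℝ) : Matrix (Fin ((p + 1) * 3)) (Fin ((p + 1) * 3)) ℝ :=
  ((layerRoot p χ)ᵀ * layerRoot p χ).submatrix finProdFinEquiv.symm finProdFinEquiv.symm

lemma layerGossip_isSymm : (layerGossip p χ).IsSymm := by
  rw [layerGossip, IsSymm, transpose_submatrix, transpose_mul, transpose_transpose]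

lemma layerGossip_mulVec (v : Fin ((p + 1) * 3) → ℝ) :
    layerGossip p χ *ᵥ v =
      ((layerRoot p χ)ᵀ *ᵥ (layerRoot p χ *ᵥ (v ∘ finProdFinEquiv))) ∘ finProdFinEquiv.symm := by
  rw [layerGossip, submatrix_mulVec_equiv, mulVec_mulVec, Equiv.symm_symm]

lemma dotProduct_layerGossip_mulVec (v : Fin ((p + 1) * 3) → ℝ) :
    v ⬝ᵥ layerGossip p χ *ᵥ v = ∑ a, (layerRoot p χ *ᵥ (v ∘ finProdFinEquiv)) a ^ 2 := by
  rw [layerGossip_mulVec, dotProduct_comp_equiv_symm, dotProduct_mulVec, vecMul_transpose]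
  simp [dotProduct, sq]

lemma layerGossip_mulVec_eq_zero_iff (hχ : 0 < χ) (v : Fin ((p + 1) * 3) → ℝ) :
    layerGossip p χ *ᵥ v = 0 ↔ ∃ a : ℝ, v = fun _ => a := by
  constructor
  · intro h
    set w := v ∘ finProdFinEquiv with hw
    have h0 : ∑ a, (layerRoot p χ *ᵥ w) a ^ 2 = 0 := by
      rw [← dotProduct_layerGossip_mulVec, h, dotProduct_zero]
    rw [Finset.sum_eq_zero_iff_of_nonneg fun _ _ => sq_nonneg _] at h0
    have h1 : ∀ a, (layerRoot p χ *ᵥ w) a = 0 := fun a => by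
      simpa using h0 a (Finset.mem_univ a)
    have h01 : ∀ k, w (k, 0) = w (k, 1) := fun k => by
      have := h1 (k, 1)
      rw [layerRoot_mulVec_one] at this
      have h2 : 1 / √(2 : ℝ) ≠ 0 := by positivity
      linarith [(mul_eq_zero.1 this).resolve_left h2]
    have h02 : ∀ k, w (k, 0) = w (k, 2) := fun k => by
      have := h1 (k, 2)
      rw [layerRoot_mulVec_two] at this
      have h2 : 1 / √(6 * χ) ≠ 0 := by positivity
      linarith [(mul_eq_zero.1 this).resolve_left h2, h01 k]
    have hs : ∀ k : Fin (p + 1), layerSum w k = 3 * w (k, 0) := fun k => by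
      rw [layerSum_fin, ← h01, ← h02]; ring
    have hc : ∀ k : ℕ, k < p + 1 → layerSum w k = layerSum w 0 := by
      intro k
      induction k with
      | zero => intro; rfl
      | succ k ih =>
        intro hk
        rw [← ih (by omega)]
        have := h1 (⟨k, by omega⟩, 0)
        rw [layerRoot_mulVec_zero, if_pos (by simp; omega)] at this
        have h2 : √(1 / 12 : ℝ) ≠ 0 := by positivity
        have := (mul_eq_zero.1 this).resolve_left h2
        simp only at this
        linarith
    have hall : ∀ a, w a = w (0, 0) := by
      rintro ⟨k, s⟩
      have hk : w (k, 0) = w (0, 0) := by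
        have := hc k k.2
        have h3 : layerSum w 0 = 3 * w (0, 0) := hs 0
        rw [hs k, h3] at this
        linarith
      fin_cases s
      · exact hk
      · exact (h01 k).symm.trans hk
      · exact (h02 k).symm.trans hk
    refine ⟨w (0, 0), funext fun i => ?_⟩
    rw [← hall (finProdFinEquiv.symm i)]
    rw [hw, Function.comp_apply, Equiv.apply_symm_apply]
  · rintro ⟨a, rfl⟩
    rw [layerGossip_mulVec]
    have : layerRoot p χ *ᵥ ((fun _ => a) ∘ finProdFinEquiv) = 0 := by
      ext ⟨k, s⟩
      have hs : ∀ k, k < p + 1 → layerSum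
          ((fun _ => a) ∘ finProdFinEquiv : Fin (p + 1) × Fin 3 → ℝ) k = 3 * a := fun k hk => by
        rw [layerSum, dif_pos hk]; simp
      fin_cases s
      · show (layerRoot p χ *ᵥ _) (k, 0) = 0
        rw [layerRoot_mulVec_zero]
        split_ifs with h
        · rw [hs _ k.2, hs _ (by omega), sub_self, mul_zero]
        · rfl
      · show (layerRoot p χ *ᵥ _) (k, 1) = 0
        rw [layerRoot_mulVec_one]; simp
      · show (layerRoot p χ *ᵥ _) (k, 2) = 0
        rw [layerRoot_mulVec_two]; simp; right; ring
    rw [this, mulVec_zero]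
    rfl

lemma layerGossip_apply (i j : Fin ((p + 1) * 3)) :
    layerGossip p χ i j = ∑ a, layerRoot p χ a (finProdFinEquiv.symm i) *
      layerRoot p χ a (finProdFinEquiv.symm j) := by
  simp [layerGossip, mul_apply]

/-- Nodes in layers that are not adjacent are not linked. -/
lemma layerGossip_support {i j : Fin ((p + 1) * 3)} (h : layerGossip p χ i j ≠ 0) :
    ((finProdFinEquiv.symm i).1 : ℕ) ≤ (finProdFinEquiv.symm j).1 + 1 := by
  by_contra hlt
  refine h ?_
  rw [layerGossip_apply]
  refine Finset.sum_eq_zero fun a _ => ?_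
  obtain ⟨k, s⟩ := a
  generalize finProdFinEquiv.symm i = x at *
  generalize finProdFinEquiv.symm j = y at *
  rw [mul_eq_zero, or_iff_not_imp_left]
  intro hx
  by_cases hk : k = y.1
  · exfalso
    apply hx
    have h1 : ¬ k = x.1 := by rw [hk, Fin.ext_iff]; omega
    have h2 : ¬ ((k : ℕ) + 1 = x.1) := by rw [hk]; omega
    fin_cases s <;> simp [layerRoot, h1, h2]
  · by_cases h3 : (k : ℕ) + 1 = y.1
    · exfalso
      apply hx
      have h1 : ¬ k = x.1 := by rw [Fin.ext_iff]; omega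
      have h2 : ¬ ((k : ℕ) + 1 = x.1) := by omega
      fin_cases s <;> simp [layerRoot, h1, h2]
    · fin_cases s <;> simp [layerRoot, hk, h3]

lemma layerGossip_diag_ne_zero (hχ : 0 < χ) (i : Fin ((p + 1) * 3)) : layerGossip p χ i i ≠ 0 := by
  rw [layerGossip_apply]
  generalize finProdFinEquiv.symm i = x
  obtain ⟨k, s⟩ := x
  have h : layerRoot p χ (k, 2) (k, s) ≠ 0 := by
    have h6 : √(6 * χ) ≠ 0 := by positivity
    fin_cases s <;> simpa [layerRoot, -Real.sqrt_mul] using h6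
  refine (Finset.sum_pos' (fun a _ => mul_self_nonneg _) ⟨(k, 2), Finset.mem_univ _, ?_⟩).ne'
  exact mul_self_pos.2 h

/-- A row of the root which the root maps to a multiple of the corresponding unit vector is an
eigenvector. -/
lemma layerGossip_eigenvector {c : ℝ} (a : Fin (p + 1) × Fin 3)
    (h : layerRoot p χ *ᵥ layerRoot p χ a = Pi.single a c) (hc : c ≠ 0) :
    ∃ v ≠ 0, layerGossip p χ *ᵥ v = c • v := by
  refine ⟨layerRoot p χ a ∘ finProdFinEquiv.symm, fun h0 => hc ?_, ?_⟩
  · have h1 : layerRoot p χ a = 0 := by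
      ext b; simpa using congrFun h0 (finProdFinEquiv b)
    rw [h1, mulVec_zero] at h
    simpa using (congrFun h a).symm
  · have h1 : (layerRoot p χ a ∘ finProdFinEquiv.symm) ∘ finProdFinEquiv = layerRoot p χ a := by
      ext b; simp
    rw [layerGossip_mulVec, h1, h, mulVec_single]
    ext i
    simp

lemma isFixedNetwork_layerGossip (hχ : 1 ≤ χ) (hp : p = 0 ∨ 4 * (p + 1 : ℝ) ^ 2 ≤ χ) :
    IsFixedNetwork (supportGraph (layerGossip p χ) layerGossip_isSymm) (layerGossip p χ) χ := by
  have hχ0 : 0 < χ := by linarith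
  have hχ1 : 1 / χ ≤ 1 := by rw [div_le_one hχ0]; exact hχ
  have hsum : ∀ v : Fin ((p + 1) * 3) → ℝ, v ⬝ᵥ v = ∑ a, (v ∘ finProdFinEquiv) a ^ 2 := by
    intro v
    rw [dotProduct, ← finProdFinEquiv.sum_comp]
    simp [sq]
  have : Nonempty (Fin ((p + 1) * 3)) := ⟨⟨0, by omega⟩⟩
  refine isFixedNetwork_supportGraph _ hχ0 layerGossip_isSymm (layerGossip_mulVec_eq_zero_iff hχ0)
    (layerGossip_diag_ne_zero hχ0) (fun v => ?_) (fun v => ?_) (fun v hv => ?_) ?_ ?_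
  · rw [dotProduct_layerGossip_mulVec]
    exact Finset.sum_nonneg fun _ _ => sq_nonneg _
  · rw [dotProduct_layerGossip_mulVec, hsum, sum_sq_layerRoot_mulVec hχ0, sum_sq_eq_layers]
    refine add_le_add ?_ (Finset.sum_le_sum fun k _ => ?_)
    · linarith [sum_sq_sub_le (layerSum (v ∘ finProdFinEquiv)) p]
    · gcongr
      exact mul_le_of_le_one_left (by positivity) hχ1
  · rw [dotProduct_layerGossip_mulVec, hsum, sum_sq_layerRoot_mulVec hχ0, sum_sq_eq_layers,
      mul_add]
    have h0 : ∑ k ∈ Finset.range (p + 1), layerSum (v ∘ finProdFinEquiv) k = 0 := by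
      rw [sum_layerSum, ← hv]
      exact finProdFinEquiv.sum_comp v
    have h1 := sum_sq_le_of_sum_eq_zero _ p h0
    refine add_le_add ?_ ?_
    · rcases hp with rfl | hp
      · simp only [zero_add, Finset.range_one, Finset.sum_singleton] at h0
        simp [h0]
      · have h2 : 0 ≤ ∑ k ∈ Finset.range p, (layerSum (v ∘ finProdFinEquiv) k -
            layerSum (v ∘ finProdFinEquiv) (k + 1)) ^ 2 := Finset.sum_nonneg fun _ _ => sq_nonneg _
        rw [div_mul_eq_mul_div, one_mul, div_le_iff₀ hχ0]
        nlinarith [mul_le_mul_of_nonneg_right hp h2]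
    · rw [Finset.mul_sum]
      refine Finset.sum_le_sum fun k _ => ?_
      rw [mul_add]
      gcongr
      exact mul_le_of_le_one_left (by positivity) hχ1
  · refine layerGossip_eigenvector (0, 1) ?_ one_ne_zero
    have h2 : √(2 : ℝ) ^ 2 = 2 := Real.sq_sqrt (by norm_num)
    ext ⟨k, s⟩
    have hs : ∀ j, layerSum (layerRoot p χ (0, 1)) j = 0 := fun j => by
      rw [layerSum]
      split_ifs
      · simp [Fin.sum_univ_three, layerRoot]
      · rfl
    fin_cases s
    · show (layerRoot p χ *ᵥ _) (k, 0) = _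
      rw [layerRoot_mulVec_zero, hs, hs]; simp
    · show (layerRoot p χ *ᵥ _) (k, 1) = (Pi.single (0, 1) 1 : Fin (p + 1) × Fin 3 → ℝ) (k, 1)
      rw [layerRoot_mulVec_one]
      by_cases hk : k = 0
      · subst hk; simp [layerRoot]; field_simp; rw [h2]; norm_num
      · simp [layerRoot, hk, Ne.symm hk]
    · show (layerRoot p χ *ᵥ _) (k, 2) = _
      rw [layerRoot_mulVec_two]
      by_cases hk : k = 0
      · subst hk; simp [layerRoot]
      · simp [layerRoot, hk, Ne.symm hk]
  · refine layerGossip_eigenvector (0, 2) ?_ (by positivity)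
    have h2 : √(6 * χ) ^ 2 = 6 * χ := Real.sq_sqrt (by positivity)
    ext ⟨k, s⟩
    have hs : ∀ j, layerSum (layerRoot p χ (0, 2)) j = 0 := fun j => by
      rw [layerSum]
      split_ifs
      · simp [Fin.sum_univ_three, layerRoot, -Real.sqrt_mul]
        intro; ring
      · rfl
    fin_cases s
    · show (layerRoot p χ *ᵥ _) (k, 0) = _
      rw [layerRoot_mulVec_zero, hs, hs]; simp
    · show (layerRoot p χ *ᵥ _) (k, 1) = _
      rw [layerRoot_mulVec_one]
      by_cases hk : k = 0
      · subst hk; simp [layerRoot]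
      · simp [layerRoot, hk, Ne.symm hk]
    · show (layerRoot p χ *ᵥ _) (k, 2) = (Pi.single (0, 2) (1 / χ) : Fin (p + 1) × Fin 3 → ℝ) (k, 2)
      rw [layerRoot_mulVec_two]
      by_cases hk : k = 0
      · subst hk
        simp [layerRoot, -Real.sqrt_mul]
        field_simp
        rw [h2]
        ring
      · simp [layerRoot, hk, Ne.symm hk]

end DecVI

/-! ### The chain operators -/

namespace DecVI

variable {d : ℕ}

/-- The skew-symmetric coupling of the pairs `(k, k + 1)` with `k ≡ par` modulo `2` of a sequence.
-/
def link (x : ℕ → ℝ) (par k : ℕ) : ℝ :=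
  if k % 2 = par then x (k + 1) else if k = 0 then 0 else -x (k - 1)

/-- The coordinates of `z`, continued beyond the last one by a geometric progression of ratio `q`.
-/
noncomputable def chainExt (q : ℝ) (z : Vec d) (k : ℕ) : ℝ :=
  if h : k < d then z ⟨k, h⟩ else if h : k - 1 < d then q * z ⟨k - 1, h⟩ else 0

/-- The affine operator `z ↦ ν z + β S z - b e₀`, where `S` couples the pairs of coordinates `(k,
k + 1)` with `k ≡ par` modulo `2`; if the last coordinate has no partner, its partner is taken to
be `q` times itself. -/
noncomputable def chainOp (ν β q b : ℝ) (par : ℕ) (z : Vec d) : Vec d :=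
  WithLp.toLp 2 fun k => ν * z k + β * link (chainExt q z) par k - if (k : ℕ) = 0 then b else 0

lemma chainExt_of_lt (q : ℝ) (z : Vec d) (k : Fin d) : chainExt q z k = z k := by
  rw [chainExt, dif_pos k.2]

lemma chainExt_last (q : ℝ) (z : Vec d) : chainExt q z d = q * chainExt q z (d - 1) := by
  rcases Nat.eq_zero_or_pos d with rfl | h
  · simp [chainExt]
  · have h1 : d - 1 < d := by omega
    simp [chainExt, h1]

lemma chainExt_sub (q : ℝ) (u v : Vec d) (k : ℕ) :
    chainExt q (u - v) k = chainExt q u k - chainExt q v k := by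
  unfold chainExt
  split_ifs <;> simp [mul_sub]

lemma link_sub (x y : ℕ → ℝ) (par k : ℕ) :
    link (fun k => x k - y k) par k = link x par k - link y par k := by
  unfold link
  split_ifs <;> ring

/-- The boundary terms left over after summing the quadratic form of `link` up to index `k`. -/
lemma sum_link_mul (x : ℕ → ℝ) (par k : ℕ) (hpar : par < 2) :
    ∑ j ∈ Finset.range k, link x par j * x j =
      if k % 2 = par ∨ k = 0 then 0 else x (k - 1) * x k := by
  induction k with
  | zero => simp
  | succ k ih =>
    rw [Finset.sum_range_succ, ih, link]
    have e : k + 1 - 1 = k := by omega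
    simp only [e, Nat.succ_ne_zero, or_false]
    split_ifs <;> first | omega | ring

lemma sum_link_mul_nonneg {q : ℝ} (hq : 0 ≤ q) (x : ℕ → ℝ) (par k : ℕ) (hpar : par < 2)
    (hx : x k = q * x (k - 1)) : 0 ≤ ∑ j ∈ Finset.range k, link x par j * x j := by
  rw [sum_link_mul x par k hpar, hx]
  split_ifs
  · rfl
  · nlinarith [mul_self_nonneg (x (k - 1))]

lemma sum_link_sq_le (ν β : ℝ) (x : ℕ → ℝ) (par k : ℕ) (hpar : par < 2) :
    ∑ j ∈ Finset.range k, ((ν * x j + β * link x par j) ^ 2 - (ν ^ 2 + β ^ 2) * x j ^ 2) ≤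
      if k % 2 = par ∨ k = 0 then 0
      else 2 * ν * β * (x (k - 1) * x k) + β ^ 2 * (x k ^ 2 - x (k - 1) ^ 2) := by
  induction k with
  | zero => simp
  | succ k ih =>
    rw [Finset.sum_range_succ, link]
    have e : k + 1 - 1 = k := by omega
    simp only [e, Nat.succ_ne_zero, or_false]
    split_ifs at ih ⊢ <;> first | omega | nlinarith [sq_nonneg (β * x k)]

/-- The extra diagonal entry at the end of the chain is harmless because of `2νqβ ≤ β²(1 - q²)`. -/
lemma sum_link_sq_le' {ν β q : ℝ} (h : 2 * ν * q * β ≤ β ^ 2 * (1 - q ^ 2)) (x : ℕ → ℝ)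
    (par k : ℕ) (hpar : par < 2) (hx : x k = q * x (k - 1)) :
    ∑ j ∈ Finset.range k, (ν * x j + β * link x par j) ^ 2 ≤
      (ν ^ 2 + β ^ 2) * ∑ j ∈ Finset.range k, x j ^ 2 := by
  have h1 := sum_link_sq_le ν β x par k hpar
  rw [Finset.sum_sub_distrib, ← Finset.mul_sum, hx] at h1
  split_ifs at h1
  · linarith
  · nlinarith [mul_le_mul_of_nonneg_right h (sq_nonneg (x (k - 1)))]

lemma chainOp_sub_apply (ν β q b : ℝ) (par : ℕ) (u v : Vec d) (k : Fin d) :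
    (chainOp ν β q b par u - chainOp ν β q b par v) k =
      ν * chainExt q (u - v) k + β * link (chainExt q (u - v)) par k := by
  have h : chainExt q (u - v) = fun k => chainExt q u k - chainExt q v k :=
    funext fun k => chainExt_sub q u v k
  rw [h, link_sub]
  simp only [chainOp, PiLp.sub_apply, chainExt_of_lt]
  ring

lemma norm_sq_eq_sum (q : ℝ) (z : Vec d) :
    ‖z‖ ^ 2 = ∑ k ∈ Finset.range d, chainExt q z k ^ 2 := by
  rw [EuclideanSpace.norm_sq_eq, ← Fin.sum_univ_eq_sum_range (fun k => chainExt q z k ^ 2)]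
  simp [chainExt_of_lt]

lemma chainOp_stronglyMonotone {ν β q : ℝ} (b : ℝ) {par : ℕ} (hβ : 0 ≤ β) (hq : 0 ≤ q)
    (hpar : par < 2) : StronglyMonotone (chainOp (d := d) ν β q b par) ν := by
  intro u v
  have h1 : inner ℝ (chainOp ν β q b par u - chainOp ν β q b par v) (u - v) =
      ∑ k ∈ Finset.range d, (ν * chainExt q (u - v) k ^ 2 +
        β * (link (chainExt q (u - v)) par k * chainExt q (u - v) k)) := by
    rw [← Fin.sum_univ_eq_sum_range (fun k => ν * chainExt q (u - v) k ^ 2 +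
        β * (link (chainExt q (u - v)) par k * chainExt q (u - v) k)), PiLp.inner_apply]
    refine Finset.sum_congr rfl fun k _ => ?_
    rw [chainOp_sub_apply, ← chainExt_of_lt q (u - v) k]
    simp only [RCLike.inner_apply, conj_trivial]
    ring
  rw [h1, Finset.sum_add_distrib, ← Finset.mul_sum, ← Finset.mul_sum, ← norm_sq_eq_sum]
  have := sum_link_mul_nonneg hq (chainExt q (u - v)) par d hpar (chainExt_last q _)
  nlinarith

lemma chainOp_lipschitz {ν β q L : ℝ} (b : ℝ) {par : ℕ} (hL : 0 ≤ L) (hνβ : ν ^ 2 + β ^ 2 ≤ L ^ 2)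
    (h : 2 * ν * q * β ≤ β ^ 2 * (1 - q ^ 2)) (hpar : par < 2) :
    LipschitzOp (chainOp (d := d) ν β q b par) L := by
  intro u v
  refine (sq_le_sq₀ (norm_nonneg _) (by positivity)).1 ?_
  have h1 := sum_link_sq_le' h (chainExt q (u - v)) par d hpar (chainExt_last q _)
  rw [← norm_sq_eq_sum] at h1
  rw [mul_pow, EuclideanSpace.norm_sq_eq]
  refine le_trans (le_of_eq ?_) (h1.trans (mul_le_mul_of_nonneg_right hνβ (sq_nonneg _)))
  rw [← Fin.sum_univ_eq_sum_range
    (fun k => (ν * chainExt q (u - v) k + β * link (chainExt q (u - v)) par k) ^ 2)]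
  refine Finset.sum_congr rfl fun k _ => ?_
  rw [chainOp_sub_apply, Real.norm_eq_abs, sq_abs]

/-- The vectors whose coordinates with index at least `j` vanish. -/
def lowCoords (d j : ℕ) : Submodule ℝ (Vec d) where
  carrier := {z | ∀ k : Fin d, j ≤ k → z k = 0}
  add_mem' := fun hx hy k hk => by simp [hx k hk, hy k hk]
  zero_mem' := fun k _ => by simp
  smul_mem' := fun c x hx k hk => by simp [hx k hk]

lemma lowCoords_mono {i j : ℕ} (h : i ≤ j) : lowCoords d i ≤ lowCoords d j :=
  fun _ hz k hk => hz k (h.trans hk)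

lemma chainExt_succ_eq_zero {q : ℝ} {j : ℕ} {z : Vec d} (hz : z ∈ lowCoords d j) {k : ℕ}
    (hk : j ≤ k) : chainExt q z (k + 1) = 0 := by
  unfold chainExt
  split_ifs with h1 h2
  · exact hz _ (by simp; omega)
  · rw [hz _ (by simpa using hk), mul_zero]
  · rfl

/-- One application of a chain operator reveals at most one further coordinate. -/
lemma chainOp_mem_lowCoords_succ {ν β q b : ℝ} {par j : ℕ} {z : Vec d}
    (hz : z ∈ lowCoords d (j + 1)) : chainOp ν β q b par z ∈ lowCoords d (j + 2) := by
  intro k hk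
  have h1 : z k = 0 := hz k (by omega)
  have h2 : chainExt q z (k + 1) = 0 := chainExt_succ_eq_zero hz (by omega)
  have h3 : chainExt q z (k - 1) = 0 := by
    obtain ⟨i, hi⟩ : ∃ i, (k : ℕ) - 1 = i + 1 := ⟨k - 2, by omega⟩
    have h4 : (k : ℕ) - 1 < d := by omega
    rw [chainExt, dif_pos h4]
    exact hz _ (by simp only; omega)
  have h4 : (k : ℕ) ≠ 0 := by omega
  simp [chainOp, link, h1, h2, h3, h4]

/-- It reveals none unless the parity is right. -/
lemma chainOp_mem_lowCoords {ν β q b : ℝ} {par j : ℕ} {z : Vec d} (hpar : par < 2)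
    (h : β = 0 ∨ j % 2 ≠ par) (hz : z ∈ lowCoords d (j + 1)) :
    chainOp ν β q b par z ∈ lowCoords d (j + 1) := by
  intro k hk
  have h1 : z k = 0 := hz k (by omega)
  have h4 : (k : ℕ) ≠ 0 := by omega
  rcases h with rfl | h
  · simp [chainOp, h1, h4]
  have h2 : chainExt q z (k + 1) = 0 := chainExt_succ_eq_zero hz (by omega)
  by_cases hkp : (k : ℕ) % 2 = par
  · simp [chainOp, link, h1, h2, h4, hkp]
  · have h3 : chainExt q z (k - 1) = 0 := by
      have h5 : (k : ℕ) - 1 < d := by omega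
      rw [chainExt, dif_pos h5]
      exact hz _ (by simp only; omega)
    simp [chainOp, link, h1, h3, h4, hkp]

/-! ### The hard problem -/

variable {M : ℕ}

/-- The local operator of worker `m`: the workers in `A` hold the even links of the chain and the
constant term, those in `B` the odd links, and the others only the multiple `ν z`. -/
noncomputable def workerOp (A B : Finset (Fin M)) (ν β q b : ℝ) (m : Fin M) : Vec d → Vec d :=
  chainOp ν (if m ∈ A ∪ B then β else 0) q (if m ∈ A then b else 0) (if m ∈ B then 1 else 0)

/-- The hard problem: for each worker, the whole local operator sits in the first component. -/
noncomputable def chainProblem (A B : Finset (Fin M)) (n d : ℕ) (ν β q b : ℝ) : Problem M n d where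
  comp m i z := if (i : ℕ) = 0 then (n : ℝ) • workerOp A B ν β q b m z else 0
  g _ := 0
  g_ne_bot := by simp
  g_proper := ⟨0, by simp⟩
  g_lsc := lowerSemicontinuous_const
  g_convex := by
    have h : {p : Vec d × ℝ | (0 : EReal) ≤ (p.2 : EReal)} = {p | 0 ≤ p.2} := by
      ext p; exact EReal.coe_nonneg
    rw [h]
    exact convex_halfSpace_ge (f := Prod.snd) ⟨fun _ _ => rfl, fun _ _ => rfl⟩ 0

variable {A B : Finset (Fin M)} {n : ℕ} {ν β q b L Lbar : ℝ}

lemma sum_ite_eq_zero {E : Type*} [AddCommMonoid E] (hn : 1 ≤ n) (y : E) :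
    ∑ i : Fin n, (if (i : ℕ) = 0 then y else 0) = y := by
  rw [Finset.sum_eq_single ⟨0, hn⟩]
  · simp
  · intro i _ hi
    rw [if_neg fun h => hi (Fin.ext h)]
  · simp

lemma chainProblem_localOp (hn : 1 ≤ n) (m : Fin M) (z : Vec d) :
    (chainProblem A B n d ν β q b).localOp m z = workerOp A B ν β q b m z := by
  have : (n : ℝ) ≠ 0 := by positivity
  simp only [Problem.localOp, chainProblem]
  rw [sum_ite_eq_zero hn, smul_smul, one_div_mul_cancel this, one_smul]

lemma workerOp_lipschitz (hL : 0 ≤ L) (hνβ : ν ^ 2 + β ^ 2 ≤ L ^ 2)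
    (h : 2 * ν * q * β ≤ β ^ 2 * (1 - q ^ 2)) (m : Fin M) :
    LipschitzOp (workerOp (d := d) A B ν β q b m) L := by
  refine chainOp_lipschitz _ hL ?_ ?_ (by split_ifs <;> norm_num)
  · split_ifs
    · exact hνβ
    · nlinarith [sq_nonneg β]
  · split_ifs
    · exact h
    · simp

lemma workerOp_stronglyMonotone (hβ : 0 ≤ β) (hq : 0 ≤ q) (m : Fin M) :
    StronglyMonotone (workerOp (d := d) A B ν β q b m) ν :=
  chainOp_stronglyMonotone _ (by split_ifs <;> simp [hβ]) hq (by split_ifs <;> norm_num)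

lemma chainProblem_isLipschitz (hn : 1 ≤ n) (hL : 0 ≤ L) (hLbar : Lbar ^ 2 = n * L ^ 2)
    (hνβ : ν ^ 2 + β ^ 2 ≤ L ^ 2) (h : 2 * ν * q * β ≤ β ^ 2 * (1 - q ^ 2)) :
    (chainProblem A B n d ν β q b).IsLipschitz L Lbar := by
  have hn0 : (0 : ℝ) < n := by positivity
  refine ⟨fun m u v => ?_, fun m u v => ?_⟩
  · rw [chainProblem_localOp hn, chainProblem_localOp hn]
    exact workerOp_lipschitz hL hνβ h m u v
  · have h1 : ∀ i : Fin n, ‖(chainProblem A B n d ν β q b).comp m i u -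
        (chainProblem A B n d ν β q b).comp m i v‖ ^ 2 = if (i : ℕ) = 0 then
          ‖(n : ℝ) • (workerOp A B ν β q b m u - workerOp A B ν β q b m v)‖ ^ 2 else 0 := by
      intro i
      simp only [chainProblem]
      split_ifs
      · rw [smul_sub]
      · simp
    simp_rw [h1]
    rw [sum_ite_eq_zero hn, norm_smul, mul_pow, hLbar, Real.norm_of_nonneg hn0.le]
    have h2 := pow_le_pow_left₀ (norm_nonneg _)
      (workerOp_lipschitz (A := A) (B := B) (b := b) hL hνβ h m u v) 2
    rw [mul_pow] at h2
    calc 1 / (n : ℝ) * ((n : ℝ) ^ 2 * ‖workerOp A B ν β q b m u - workerOp A B ν β q b m v‖ ^ 2)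
        = n * ‖workerOp A B ν β q b m u - workerOp A B ν β q b m v‖ ^ 2 := by field_simp
      _ ≤ n * (L ^ 2 * ‖u - v‖ ^ 2) := by gcongr
      _ = _ := by ring

/-- The geometric progression `C q ^ k`. -/
noncomputable def geomVec (d : ℕ) (C q : ℝ) : Vec d := WithLp.toLp 2 fun k => C * q ^ (k : ℕ)

lemma chainExt_geomVec {C : ℝ} {k : ℕ} (hd : 0 < d) (hk : k ≤ d) :
    chainExt q (geomVec d C q) k = C * q ^ k := by
  unfold chainExt
  split_ifs with h1 h2
  · rfl
  · obtain rfl : k = d := by omega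
    simp only [geomVec]
    obtain ⟨j, rfl⟩ : ∃ j, k = j + 1 := ⟨k - 1, by omega⟩
    simp [pow_succ]; ring
  · omega

lemma workerOp_sum_apply (hAB : Disjoint A B) {r : ℕ} (hA : A.card = r) (hB : B.card = r)
    (z : Vec d) (k : Fin d) :
    (∑ m, workerOp A B ν β q b m z) k = M * ν * z k + r * (β * (link (chainExt q z) 0 k +
      link (chainExt q z) 1 k) - if (k : ℕ) = 0 then b else 0) := by
  have h1 : ∀ m, workerOp A B ν β q b m z k = ν * z k +
      ((if m ∈ A then (β * link (chainExt q z) 0 k - if (k : ℕ) = 0 then b else 0) else 0) +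
        if m ∈ B then β * link (chainExt q z) 1 k else 0) := by
    intro m
    simp only [workerOp, chainOp, Finset.mem_union]
    by_cases hmA : m ∈ A
    · have hmB : m ∉ B := Finset.disjoint_left.1 hAB hmA
      simp [hmA, hmB]; ring
    · by_cases hmB : m ∈ B <;> simp [hmA, hmB]
  have h2 : (∑ m, workerOp A B ν β q b m z) k = ∑ m, workerOp A B ν β q b m z k := by
    simp
  rw [h2]
  simp_rw [h1, Finset.sum_add_distrib, Finset.sum_ite_mem, Finset.univ_inter, Finset.sum_const,
    hA, hB]
  simp
  ring

/-- The geometric progression of ratio `q` solves the problem when `r β (1 - q²) = M ν q`. -/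
lemma chainProblem_isSolution (hn : 1 ≤ n) (hd : 0 < d) (hAB : Disjoint A B) {r : ℕ} {C : ℝ}
    (hA : A.card = r) (hB : B.card = r) (hq : r * β * (1 - q ^ 2) = M * ν * q) (hb : b * q = C * β)
    (hq0 : q ≠ 0) :
    (chainProblem A B n d ν β q b).IsSolution (geomVec d C q) := by
  have h : (chainProblem A B n d ν β q b).op (geomVec d C q) = 0 := by
    ext k
    simp only [Problem.op, chainProblem_localOp hn]
    rw [workerOp_sum_apply hAB hA hB, ← chainExt_of_lt q, chainExt_geomVec hd k.2.le]
    rcases Nat.eq_zero_or_pos (k : ℕ) with hk | hk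
    · simp only [hk, link]
      simp only [Nat.zero_mod, if_true, zero_ne_one, if_false]
      rw [chainExt_geomVec hd (by omega)]
      simp only [PiLp.zero_apply]
      apply mul_left_cancel₀ hq0
      linear_combination -C * hq - r * hb
    · obtain ⟨j, hj⟩ : ∃ j, (k : ℕ) = j + 1 := ⟨k - 1, by omega⟩
      have h1 : link (chainExt q (geomVec d C q)) 0 k + link (chainExt q (geomVec d C q)) 1 k =
          C * q ^ (j + 2) - C * q ^ j := by
        have e1 := chainExt_geomVec (q := q) (C := C) hd (by omega : j + 2 ≤ d)
        have e2 := chainExt_geomVec (q := q) (C := C) hd (by omega : j ≤ d)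
        rw [hj, link, link]
        simp only [Nat.add_sub_cancel, Nat.succ_ne_zero, if_false, add_assoc, Nat.reduceAdd, e1, e2]
        split_ifs <;> first | omega | ring
      rw [h1, hj]
      simp only [Nat.succ_ne_zero, if_false, PiLp.zero_apply]
      linear_combination -C * q ^ j * hq
  intro z
  rw [h]
  simp [chainProblem]

lemma norm_geomVec_sq (C q : ℝ) :
    ‖geomVec d C q‖ ^ 2 = C ^ 2 * ∑ k ∈ Finset.range d, (q ^ 2) ^ k := by
  rw [EuclideanSpace.norm_sq_eq, Finset.mul_sum,
    ← Fin.sum_univ_eq_sum_range (fun k => C ^ 2 * (q ^ 2) ^ k)]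
  refine Finset.sum_congr rfl fun k _ => ?_
  simp only [geomVec, Real.norm_eq_abs, sq_abs]
  ring

lemma norm_sub_geomVec_ge {C : ℝ} (hq0 : 0 ≤ q) (hq1 : q < 1) {j : ℕ} {y : Vec d}
    (hy : y ∈ lowCoords d j) :
    ‖geomVec d C q‖ ^ 2 * ((q ^ 2) ^ j - (q ^ 2) ^ d) ≤ ‖y - geomVec d C q‖ ^ 2 := by
  have hp0 : 0 ≤ q ^ 2 := sq_nonneg q
  have hp1 : q ^ 2 < 1 := by nlinarith
  rcases le_total d j with hjd | hjd
  · refine le_trans ?_ (sq_nonneg _)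
    refine mul_nonpos_of_nonneg_of_nonpos (sq_nonneg _) ?_
    linarith [pow_le_pow_of_le_one hp0 hp1.le hjd]
  have h1 : C ^ 2 * ∑ k ∈ Finset.Ico j d, (q ^ 2) ^ k ≤ ‖y - geomVec d C q‖ ^ 2 := by
    rw [EuclideanSpace.norm_sq_eq]
    have h2 : ∑ k ∈ Finset.Ico j d, C ^ 2 * (q ^ 2) ^ k =
        ∑ k ∈ Finset.range d, if j ≤ k then C ^ 2 * (q ^ 2) ^ k else 0 := by
      rw [← Finset.sum_filter]
      refine Finset.sum_congr ?_ fun _ _ => rfl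
      ext k; simp; omega
    rw [Finset.mul_sum, h2,
      ← Fin.sum_univ_eq_sum_range (fun k => if j ≤ k then C ^ 2 * (q ^ 2) ^ k else 0)]
    refine Finset.sum_le_sum fun k _ => ?_
    split_ifs with hk
    · rw [PiLp.sub_apply, hy k hk]
      simp only [geomVec, Real.norm_eq_abs, sq_abs]
      exact le_of_eq (by ring)
    · positivity
  have h2 : (∑ k ∈ Finset.Ico j d, (q ^ 2) ^ k) * (1 - q ^ 2) = (q ^ 2) ^ j - (q ^ 2) ^ d := by
    have := geom_sum_Ico_mul_neg (q ^ 2) hjd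
    simpa using this
  have h3 : (∑ k ∈ Finset.range d, (q ^ 2) ^ k) * (1 - q ^ 2) = 1 - (q ^ 2) ^ d :=
    geom_sum_mul_neg _ _
  refine le_trans ?_ h1
  rw [norm_geomVec_sq, mul_assoc]
  refine mul_le_mul_of_nonneg_left ?_ (sq_nonneg C)
  rw [← h2, ← mul_assoc, mul_comm _ (1 - q ^ 2), ← mul_assoc, mul_comm (1 - q ^ 2), h3]
  refine mul_le_of_le_one_left (Finset.sum_nonneg fun _ _ => by positivity) ?_
  linarith [pow_nonneg hp0 d]

end DecVI

/-! ### Sampling -/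

namespace DecVI

/-- The probability of the set `S` when a set of size `b` is sampled uniformly from `n` elements. -/
noncomputable def sampleWeight (n b : ℕ) (S : Finset (Fin n)) : ℝ≥0∞ :=
  if S.card = b then ((n.choose b : ℕ) : ℝ≥0∞)⁻¹ else 0

lemma sum_sampleWeight_le_one (n b : ℕ) : ∑ S, sampleWeight n b S ≤ 1 := by
  classical
  simp only [sampleWeight]
  rw [← Finset.sum_filter, Finset.sum_const, ← Finset.powerset_univ,
    ← Finset.powersetCard_eq_filter, Finset.card_powersetCard, Finset.card_univ, Fintype.card_fin, nsmul_eq_mul]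
  exact ENNReal.mul_inv_le_one _

/-- A given element is sampled with probability at most `b / n`. -/
lemma sum_sampleWeight_mem_le (n b : ℕ) (i : Fin n) :
    ∑ S, (if i ∈ S then sampleWeight n b S else 0) ≤ (b : ℝ≥0∞) / n := by
  classical
  have h1 : ∑ S, (if i ∈ S then sampleWeight n b S else 0) =
      (((Finset.powersetCard b Finset.univ).filter ({i} ⊆ ·)).card : ℝ≥0∞) *
        ((n.choose b : ℕ) : ℝ≥0∞)⁻¹ := by
    rw [← nsmul_eq_mul, ← Finset.sum_const, Finset.sum_filter, Finset.powersetCard_eq_filter,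
      Finset.sum_filter, Finset.powerset_univ]
    refine Finset.sum_congr rfl fun S _ => ?_
    simp only [sampleWeight, Finset.singleton_subset_iff]
    split_ifs <;> rfl
  rw [h1]
  obtain ⟨n, rfl⟩ : ∃ k, n = k + 1 := ⟨n - 1, by have := i.2; omega⟩
  rcases b with _ | b
  · simp [Finset.filter_singleton]
  · rw [Finset.card_filter_powersetCard_subset _ _ _ (Finset.subset_univ _) (by simp)]
    simp only [Finset.card_univ, Fintype.card_fin, Finset.card_singleton, Nat.add_sub_cancel]
    by_cases h0 : (n + 1).choose (b + 1) = 0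
    · have h2 : n.choose b = 0 := by
        rw [Nat.choose_eq_zero_iff] at h0 ⊢; omega
      simp [h2]
    · rw [← div_eq_mul_inv]
      refine ENNReal.div_le_of_le_mul ?_
      have h2 : ((n + 1 : ℕ) : ℝ≥0∞) ≠ 0 := by simp
      rw [mul_comm, ← mul_div_assoc,
        ENNReal.le_div_iff_mul_le (.inl h2) (.inl (ENNReal.natCast_ne_top _))]
      have := Nat.add_one_mul_choose_eq n b
      rw [mul_comm]
      exact_mod_cast this.le

/-- The product measure behind independent samples gives the event `i ∈ s m` a weight of at most
`b m / n`. -/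
lemma sum_prod_sampleWeight_le {M n : ℕ} (b : Fin M → ℕ) (m : Fin M) (i : Fin n) :
    ∑ s ∈ {s : Fin M → Finset (Fin n) | i ∈ s m}, ∏ j, sampleWeight n (b j) (s j) ≤
      (b m : ℝ≥0∞) / n := by
  classical
  have h1 : ∑ s ∈ {s : Fin M → Finset (Fin n) | i ∈ s m}, ∏ j, sampleWeight n (b j) (s j) =
      ∏ j, ∑ S, if j = m then (if i ∈ S then sampleWeight n (b j) S else 0)
        else sampleWeight n (b j) S := by
    rw [Finset.prod_univ_sum, Fintype.piFinset_univ, Finset.sum_filter]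
    refine Finset.sum_congr rfl fun s _ => ?_
    split_ifs with h
    · refine Finset.prod_congr rfl fun j _ => ?_
      split_ifs with hj h' <;> first | rfl | (subst hj; exact absurd h h')
    · exact (Finset.prod_eq_zero (Finset.mem_univ m) (by simp [h])).symm
  rw [h1, ← Finset.mul_prod_erase _ _ (Finset.mem_univ m)]
  refine mul_le_of_le_of_le_one ?_ (Finset.prod_le_one' fun j hj => ?_)
  · simpa using sum_sampleWeight_mem_le n (b m) i
  · simpa [Finset.ne_of_mem_erase hj] using sum_sampleWeight_le_one n (b j)

namespace Procedure

variable {M n d : ℕ} {Q : Problem M n d} {G : SimpleGraph (Fin M)}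
  {Ω : Type} [mΩ : MeasurableSpace Ω] {P : Measure Ω}

lemma measurableSet_mem_batch (R : Procedure Q G P) (t : ℕ) (m : Fin M) (i : Fin n) :
    MeasurableSet {ω | i ∈ R.batch t m ω} := by
  have : {ω | i ∈ R.batch t m ω} = ⋃ s ∈ {s : Finset (Fin n) | i ∈ s}, {ω | R.batch t m ω = s} := by
    ext ω; simp
  rw [this]
  exact MeasurableSet.biUnion (Set.to_countable _)
    fun s _ => R.ℱ.le _ _ (R.measurable_batch t m s)

lemma measurable_size' (R : Procedure Q G P) (t : ℕ) (m : Fin M) : Measurable (R.size t m) :=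
  (R.measurable_size t m).mono (R.ℱ.le t) le_rfl

/-- A given component is sampled with probability at most the expected batch size over `n`. -/
lemma measure_mem_batch_le (R : Procedure Q G P) (t : ℕ) (m : Fin M) (i : Fin n) :
    P {ω | i ∈ R.batch t m ω} ≤ ∫⁻ ω, (R.size t m ω : ℝ≥0∞) / n ∂P := by
  classical
  have hsub : {ω | i ∈ R.batch t m ω} ⊆
      ⋃ s ∈ ({s : Fin M → Finset (Fin n) | i ∈ s m} : Finset _),
        {ω | ∀ j, R.batch t j ω = s j} := by
    intro ω hω
    simp only [Set.mem_iUnion]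
    exact ⟨fun j => R.batch t j ω, by simpa using hω, fun j => rfl⟩
  have hlaw : ∀ s : Fin M → Finset (Fin n), P {ω | ∀ j, R.batch t j ω = s j} =
      ∫⁻ ω, ∏ j, sampleWeight n (R.size t j ω) (s j) ∂P := by
    intro s
    have := R.law_batch t Set.univ MeasurableSet.univ s
    rwa [Set.univ_inter, Measure.restrict_univ] at this
  calc P {ω | i ∈ R.batch t m ω}
      ≤ ∑ s ∈ ({s : Fin M → Finset (Fin n) | i ∈ s m} : Finset _),
          P {ω | ∀ j, R.batch t j ω = s j} :=
        (measure_mono hsub).trans (measure_biUnion_finset_le _ _)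
    _ = ∫⁻ ω, ∑ s ∈ ({s : Fin M → Finset (Fin n) | i ∈ s m} : Finset _),
          ∏ j, sampleWeight n (R.size t j ω) (s j) ∂P := by
        simp_rw [hlaw]
        rw [lintegral_finsetSum]
        intro s _
        refine Finset.measurable_fun_prod _ fun j _ => ?_
        exact (measurable_of_countable fun b => sampleWeight n b (s j)).comp
          (R.measurable_size' t j)
    _ ≤ _ := lintegral_mono fun ω => sum_prod_sampleWeight_le (fun j => R.size t j ω) m i

/-- How often, before iteration `s`, a device of `S` sampled a batch with component `i`. -/
noncomputable def hits (R : Procedure Q G P) (S : Finset (Fin M)) (i : Fin n) (s : ℕ) (ω : Ω) : ℕ :=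
  ∑ t ∈ Finset.range s, ∑ m ∈ S, Set.indicator {ω | i ∈ R.batch t m ω} 1 ω

lemma measurable_hits (R : Procedure Q G P) (S : Finset (Fin M)) (i : Fin n) (s : ℕ) :
    Measurable (R.hits S i s) :=
  Finset.measurable_fun_sum _ fun t _ => Finset.measurable_fun_sum _ fun m _ =>
    measurable_one.indicator (R.measurableSet_mem_batch t m i)

lemma lintegral_hits_le [IsProbabilityMeasure P] (R : Procedure Q G P) (S : Finset (Fin M))
    (i : Fin n) {N : ℕ} (hN : ∀ᵐ ω ∂P, ∑ m ∈ S, R.calls m ω ≤ N) :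
    ∫⁻ ω, (R.hits S i R.T ω : ℝ≥0∞) ∂P ≤ (N : ℝ≥0∞) / n := by
  have h1 : ∀ t m, ∫⁻ ω, ((Set.indicator {ω | i ∈ R.batch t m ω} 1 ω : ℕ) : ℝ≥0∞) ∂P =
      P {ω | i ∈ R.batch t m ω} := by
    intro t m
    rw [← lintegral_indicator_one (R.measurableSet_mem_batch t m i)]
    refine lintegral_congr fun ω => ?_
    by_cases h : i ∈ R.batch t m ω <;> simp [Set.indicator, h]
  have hm : ∀ t m, Measurable fun ω =>
      ((Set.indicator {ω | i ∈ R.batch t m ω} 1 ω : ℕ) : ℝ≥0∞) := fun t m =>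
    (measurable_of_countable _).comp (measurable_one.indicator (R.measurableSet_mem_batch t m i))
  have hs : ∀ t m, Measurable fun ω => (R.size t m ω : ℝ≥0∞) / n := fun t m =>
    (measurable_of_countable fun k : ℕ => (k : ℝ≥0∞) / n).comp (R.measurable_size' t m)
  calc ∫⁻ ω, (R.hits S i R.T ω : ℝ≥0∞) ∂P
      = ∑ t ∈ Finset.range R.T, ∑ m ∈ S, P {ω | i ∈ R.batch t m ω} := by
        simp only [hits, Nat.cast_sum]
        rw [lintegral_finsetSum _ fun t _ => Finset.measurable_fun_sum _ fun m _ => hm t m]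
        refine Finset.sum_congr rfl fun t _ => ?_
        rw [lintegral_finsetSum _ fun m _ => hm t m]
        exact Finset.sum_congr rfl fun m _ => h1 t m
    _ ≤ ∑ t ∈ Finset.range R.T, ∑ m ∈ S, ∫⁻ ω, (R.size t m ω : ℝ≥0∞) / n ∂P :=
        Finset.sum_le_sum fun t _ => Finset.sum_le_sum fun m _ => R.measure_mem_batch_le t m i
    _ = ∫⁻ ω, ((∑ m ∈ S, R.calls m ω : ℕ) : ℝ≥0∞) / n ∂P := by
        simp_rw [← lintegral_finsetSum S fun m _ => hs _ m]
        rw [← lintegral_finsetSum _ fun t _ => Finset.measurable_fun_sum _ fun m _ => hs t m]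
        refine lintegral_congr fun ω => ?_
        simp only [calls]
        rw [Finset.sum_comm]
        simp only [Nat.cast_sum, div_eq_mul_inv, Finset.sum_mul]
    _ ≤ ∫⁻ _, (N : ℝ≥0∞) / n ∂P := by
        refine lintegral_mono_ae ?_
        filter_upwards [hN] with ω hω
        gcongr
    _ = _ := by simp

/-- By Markov's inequality, with probability at least one half fewer than `2 N / n + 1` batches
contain the component `i`. -/
lemma half_le_measure_hits_lt [IsProbabilityMeasure P] (R : Procedure Q G P) (S : Finset (Fin M))
    (i : Fin n) {N : ℕ} (hN : ∀ᵐ ω ∂P, ∑ m ∈ S, R.calls m ω ≤ N) :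
    1 / 2 ≤ P {ω | R.hits S i R.T ω < 2 * N / n + 1} := by
  have hn : 0 < n := i.pos
  set j := 2 * N / n + 1 with hj
  have hjn : 2 * N ≤ j * n := by
    have := Nat.lt_div_mul_add hn (a := 2 * N)
    rw [hj, add_mul, one_mul]; omega
  have h1 := mul_meas_ge_le_lintegral (μ := P)
    (f := fun ω => (R.hits S i R.T ω : ℝ≥0∞))
    ((measurable_of_countable _).comp (R.measurable_hits S i R.T)) j
  have h2 := h1.trans (R.lintegral_hits_le S i hN)
  have h3 : P {ω | (j : ℝ≥0∞) ≤ R.hits S i R.T ω} ≤ 1 / 2 := by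
    set p := P {ω | (j : ℝ≥0∞) ≤ R.hits S i R.T ω}
    rw [ENNReal.le_div_iff_mul_le (.inl (Nat.cast_ne_zero.2 hn.ne'))
      (.inl (ENNReal.natCast_ne_top _))] at h2
    have h4 : ((j * n : ℕ) : ℝ≥0∞) * (p * 2) ≤ ((j * n : ℕ) : ℝ≥0∞) * 1 := by
      calc ((j * n : ℕ) : ℝ≥0∞) * (p * 2) = 2 * (j * p * n) := by push_cast; ring
        _ ≤ 2 * N := by gcongr
        _ ≤ ((j * n : ℕ) : ℝ≥0∞) * 1 := by rw [mul_one]; exact_mod_cast hjn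
    have h5 : ((j * n : ℕ) : ℝ≥0∞) ≠ 0 := by
      have : j * n ≠ 0 := Nat.mul_ne_zero (Nat.succ_ne_zero _) hn.ne'
      exact_mod_cast this
    rw [ENNReal.le_div_iff_mul_le (by simp) (by simp)]
    exact (ENNReal.mul_le_mul_iff_right h5 (ENNReal.natCast_ne_top _)).1 h4
  have h6 : {ω | R.hits S i R.T ω < j} = {ω | (j : ℝ≥0∞) ≤ R.hits S i R.T ω}ᶜ := by
    ext ω; simp
  rw [h6, prob_compl_eq_one_sub]
  · calc (1 / 2 : ℝ≥0∞) = 1 - 1 / 2 := by rw [one_div, ENNReal.one_sub_inv_two]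
      _ ≤ _ := tsub_le_tsub_left h3 1
  · exact measurableSet_le measurable_const
      ((measurable_of_countable _).comp (R.measurable_hits S i R.T))

end Procedure

/-! ### Propagation of information -/

/-- With `g = 0` the proximal operators are trivial, so a local step stays in any subspace which
contains the memory and its image under the sampled operator. -/
lemma Problem.reachable_le {M n d : ℕ} (Q : Problem M n d) (hg : ∀ z, Q.g z = 0) {m : Fin M}
    {S : Finset (Fin n)} {mem : Set (Vec d)} {V : Submodule ℝ (Vec d)}
    (h1 : mem ⊆ V) (h2 : ∀ z ∈ mem, Q.batchOp m S z ∈ V) : Q.reachable m S mem ≤ V := by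
  have h3 : mem ∪ Q.batchOp m S '' mem ⊆ V := by
    rintro z (hz | ⟨y, hy, rfl⟩)
    · exact h1 hz
    · exact h2 y hy
  refine Submodule.span_le.2 (Set.union_subset h3 ?_)
  rintro p ⟨ρ, -, u, hu, hp⟩
  have h4 := hp u
  simp only [hg, mul_zero, zero_add, sub_self, norm_zero] at h4
  have h5 : ‖p - u‖ ^ 2 / 2 ≤ 0 := by
    have := EReal.coe_le_coe_iff.1 h4
    simpa using this
  have h6 : p = u := by
    have : ‖p - u‖ = 0 := by nlinarith [norm_nonneg (p - u)]
    exact sub_eq_zero.1 (norm_eq_zero.1 this)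
  rw [h6]
  exact Submodule.span_le.2 h3 hu

section Propagation

variable {M n d : ℕ} {A B : Finset (Fin M)} {ν β q b : ℝ} {G : SimpleGraph (Fin M)}
  {Ω : Type} [mΩ : MeasurableSpace Ω] {P : Measure Ω}

lemma batchOp_chainProblem_mem {V : Submodule ℝ (Vec d)} {m : Fin M} {S : Finset (Fin n)}
    {z : Vec d} (h : (∃ i ∈ S, (i : ℕ) = 0) → workerOp A B ν β q b m z ∈ V) :
    (chainProblem A B n d ν β q b).batchOp m S z ∈ V := by
  refine Submodule.sum_mem _ fun i hi => ?_
  simp only [chainProblem]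
  split_ifs with hi0
  · exact V.smul_mem _ (h ⟨i, hi, hi0⟩)
  · exact V.zero_mem

lemma Procedure.mem_local_le (R : Procedure (chainProblem A B n d ν β q b) G P) {t : ℕ} {m : Fin M}
    {ω : Ω} (ht : t < R.T) (hc : R.isComm t ω = false) {V : Submodule ℝ (Vec d)}
    (h1 : R.mem t m ω ⊆ V)
    (h2 : ∀ z ∈ R.mem t m ω, (∃ i ∈ R.batch t m ω, (i : ℕ) = 0) → workerOp A B ν β q b m z ∈ V) :
    R.mem (t + 1) m ω ⊆ V := by
  obtain ⟨X, -, hX, he⟩ := R.mem_local t m ω ht hc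
  rw [he]
  refine Set.union_subset h1 (hX.trans ?_)
  exact Problem.reachable_le _ (fun _ => rfl) h1 fun z hz => batchOp_chainProblem_mem (h2 z hz)

lemma Procedure.mem_comm_le {Q : Problem M n d} (R : Procedure Q G P) {t : ℕ} {m : Fin M} {ω : Ω}
    (ht : t < R.T) (hc : R.isComm t ω = true) {V : Submodule ℝ (Vec d)}
    (h : ∀ i, i = m ∨ G.Adj i m → R.mem t i ω ⊆ V) : R.mem (t + 1) m ω ⊆ V := by
  rw [R.mem_comm t m ω ht hc]
  exact Submodule.span_le.2 (Set.iUnion₂_subset h)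

lemma Procedure.out_mem_of_mem {Q : Problem M n d} (R : Procedure Q G P) {ω : Ω}
    {V : Submodule ℝ (Vec d)} (h : ∀ m, R.mem R.T m ω ⊆ V) : R.out ω ∈ V :=
  Submodule.span_le.2 (Set.iUnion_subset h) (R.out_mem ω)

lemma Procedure.mem_zero_subset {Q : Problem M n d} (R : Procedure Q G P) (m : Fin M) (ω : Ω)
    (V : Submodule ℝ (Vec d)) : R.mem 0 m ω ⊆ V := by
  rw [R.mem_zero]; simp

/-- Only a batch with the first component can reveal a further coordinate. -/
lemma Procedure.mem_subset_hits (R : Procedure (chainProblem A B n d ν β q b) G P) (hn : 0 < n)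
    (ω : Ω) (t : ℕ) (ht : t ≤ R.T) (m : Fin M) :
    R.mem t m ω ⊆ lowCoords d (R.hits (A ∪ B) ⟨0, hn⟩ t ω + 1) := by
  induction t generalizing m with
  | zero => exact R.mem_zero_subset m ω _
  | succ t ih =>
    have hle : R.hits (A ∪ B) ⟨0, hn⟩ t ω ≤ R.hits (A ∪ B) ⟨0, hn⟩ (t + 1) ω := by
      rw [hits, hits, Finset.sum_range_succ]; exact Nat.le_add_right _ _
    have ih' : ∀ m, R.mem t m ω ⊆ lowCoords d (R.hits (A ∪ B) ⟨0, hn⟩ (t + 1) ω + 1) :=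
      fun m => (ih (by omega) m).trans (lowCoords_mono (by omega))
    rcases hc : R.isComm t ω with _ | _
    · refine R.mem_local_le ht hc (ih' m) fun z hz ⟨i, hi, hi0⟩ => ?_
      by_cases hm : m ∈ A ∪ B
      · have h1 : R.hits (A ∪ B) ⟨0, hn⟩ t ω + 1 ≤ R.hits (A ∪ B) ⟨0, hn⟩ (t + 1) ω := by
          rw [hits, hits, Finset.sum_range_succ]
          refine Nat.add_le_add_left ?_ _
          refine le_trans ?_ (Finset.single_le_sum (fun _ _ => Nat.zero_le _) hm)
          have : (⟨0, hn⟩ : Fin n) ∈ R.batch t m ω := by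
            rwa [← show i = ⟨0, hn⟩ from Fin.ext hi0]
          simp [Set.indicator, this]
        exact lowCoords_mono (by omega) (chainOp_mem_lowCoords_succ (ih (by omega) m hz))
      · exact chainOp_mem_lowCoords (by split_ifs <;> norm_num) (.inl (if_neg hm)) (ih' m hz)
    · exact R.mem_comm_le ht hc fun i _ => ih' i

/-- The number of communication rounds after which coordinate `j + 1` may be known to a node at
distance `x` from the workers holding the even links, when those holding the odd links are at
distance `Δ`: the knowledge has to travel back and forth `j` times. -/
def arrival (Δ x j : ℕ) : ℕ := j * Δ + if j % 2 = 0 then x else Δ - x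

lemma arrival_le_add_one (Δ j : ℕ) {x y : ℕ} (h1 : x ≤ y + 1) (h2 : y ≤ x + 1) :
    arrival Δ x j ≤ arrival Δ y j + 1 := by
  unfold arrival; split_ifs <;> omega

/-- A coordinate is unknown to a node until enough communication rounds have passed. -/
lemma Procedure.mem_subset_arrival (R : Procedure (chainProblem A B n d ν β q b) G P)
    (hAB : Disjoint A B) {h : Fin M → ℕ} {Δ : ℕ}
    (hA : ∀ m ∈ A, h m = 0) (hB : ∀ m ∈ B, h m = Δ) (hG : ∀ i j, G.Adj i j → h i ≤ h j + 1)
    (ω : Ω) (t : ℕ) (ht : t ≤ R.T) (m : Fin M) (j : ℕ)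
    (hj : ∑ s ∈ Finset.range t, (if R.isComm s ω = true then 1 else 0) < arrival Δ (h m) j) :
    R.mem t m ω ⊆ lowCoords d (j + 1) := by
  induction t generalizing m j with
  | zero => exact R.mem_zero_subset m ω _
  | succ t ih =>
    rw [Finset.sum_range_succ] at hj
    rcases hc : R.isComm t ω with _ | _
    · rw [hc, if_neg (by simp), add_zero] at hj
      have h0 := ih (by omega) m j hj
      refine R.mem_local_le ht hc h0 fun z hz _ => ?_
      have hpar : (if m ∈ B then 1 else 0) < 2 := by split_ifs <;> norm_num
      -- A device which could reveal coordinate `j + 1` cannot know coordinate `j` yet.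
      have hprev : ∀ i, j = i + 1 → arrival Δ (h m) i = arrival Δ (h m) j →
          workerOp A B ν β q b m z ∈ lowCoords d (j + 1) := by
        rintro i rfl hi
        exact chainOp_mem_lowCoords_succ (ih (by omega) m i (by omega) hz)
      by_cases hmA : m ∈ A
      · have hmB : m ∉ B := Finset.disjoint_left.1 hAB hmA
        by_cases hj2 : j % 2 = 0
        · rcases j with _ | i
          · simp [arrival, hA m hmA] at hj
          · refine hprev i rfl ?_
            have hi2 : ¬ i % 2 = 0 := by omega
            simp only [arrival, hA m hmA, hj2, hi2, if_true, if_false]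
            ring_nf; omega
        · exact chainOp_mem_lowCoords hpar (.inr (by simpa [hmB] using hj2)) (h0 hz)
      · by_cases hmB : m ∈ B
        · by_cases hj2 : j % 2 = 0
          · exact chainOp_mem_lowCoords hpar (.inr (by simp [hmB, hj2])) (h0 hz)
          · rcases j with _ | i
            · simp at hj2
            · refine hprev i rfl ?_
              have hi2 : i % 2 = 0 := by omega
              simp only [arrival, hB m hmB, hj2, hi2, if_true, if_false]
              ring_nf; omega
        · exact chainOp_mem_lowCoords hpar (.inl (if_neg (by simp [hmA, hmB]))) (h0 hz)
    · rw [hc, if_pos rfl] at hj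
      refine R.mem_comm_le ht hc fun i hi => ih (by omega) i j ?_
      rcases hi with rfl | hi
      · omega
      · have := arrival_le_add_one Δ j (hG _ _ hi.symm) (hG _ _ hi)
        omega

/-- Few communication rounds leave a large error. -/
lemma Procedure.error_ge_of_rounds [IsProbabilityMeasure P]
    (R : Procedure (chainProblem A B n d ν β q b) G P)
    (hAB : Disjoint A B) {h : Fin M → ℕ} {Δ K : ℕ} {C ε : ℝ} (hε : 0 ≤ ε) (hΔ : 0 < Δ)
    (hA : ∀ m ∈ A, h m = 0) (hB : ∀ m ∈ B, h m = Δ) (hG : ∀ i j, G.Adj i j → h i ≤ h j + 1)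
    (hq0 : 0 ≤ q) (hq1 : q < 1) (hK : ∀ᵐ ω ∂P, R.rounds ω ≤ K)
    (hR : R.IsEpsSolution (geomVec d C q) ε) :
    ‖geomVec d C q‖ ^ 2 * ((q ^ 2) ^ (K / Δ + 2) - (q ^ 2) ^ d) ≤ ε := by
  rw [← ENNReal.ofReal_le_ofReal_iff hε]
  refine le_trans ?_ hR
  rw [← mul_one (ENNReal.ofReal _), ← measure_univ (μ := P), ← lintegral_const]
  refine lintegral_mono_ae ?_
  filter_upwards [hK] with ω hω
  refine ENNReal.ofReal_le_ofReal (norm_sub_geomVec_ge hq0 hq1 ?_)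
  refine R.out_mem_of_mem fun m => ?_
  refine R.mem_subset_arrival hAB hA hB hG ω R.T le_rfl m (K / Δ + 1) ?_
  have h1 : K < (K / Δ + 1) * Δ := by
    rw [add_mul, one_mul]; exact Nat.lt_div_mul_add hΔ
  have h2 : (K / Δ + 1) * Δ ≤ arrival Δ (h m) (K / Δ + 1) := Nat.le_add_right _ _
  exact lt_of_le_of_lt hω (h1.trans_le h2)

/-- Few local computations leave a large error. -/
lemma Procedure.error_ge_of_calls [IsProbabilityMeasure P]
    (R : Procedure (chainProblem A B n d ν β q b) G P) (hn : 0 < n) {N : ℕ} {C ε : ℝ} (hε : 0 ≤ ε)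
    (hq0 : 0 ≤ q) (hq1 : q < 1) (hN : ∀ᵐ ω ∂P, ∑ m ∈ A ∪ B, R.calls m ω ≤ N)
    (hR : R.IsEpsSolution (geomVec d C q) ε) :
    ‖geomVec d C q‖ ^ 2 * ((q ^ 2) ^ (2 * N / n + 1) - (q ^ 2) ^ d) ≤ 2 * ε := by
  set c := ‖geomVec d C q‖ ^ 2 * ((q ^ 2) ^ (2 * N / n + 1) - (q ^ 2) ^ d) with hc
  set X := {ω | R.hits (A ∪ B) ⟨0, hn⟩ R.T ω < 2 * N / n + 1} with hX
  have hXm : MeasurableSet X := measurableSet_lt (R.measurable_hits _ _ _) measurable_const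
  have h1 : ENNReal.ofReal c * P X ≤ ENNReal.ofReal ε := by
    refine le_trans ?_ hR
    rw [← setLIntegral_const]
    refine le_trans (setLIntegral_mono' hXm fun ω hω => ?_) (setLIntegral_le_lintegral X _)
    refine ENNReal.ofReal_le_ofReal (norm_sub_geomVec_ge hq0 hq1 ?_)
    refine R.out_mem_of_mem fun m => (R.mem_subset_hits hn ω R.T le_rfl m).trans ?_
    exact lowCoords_mono (Nat.succ_le_of_lt hω)
  have h2 : ENNReal.ofReal c * (1 / 2) ≤ ENNReal.ofReal ε :=
    le_trans (mul_le_mul_right (R.half_le_measure_hits_lt (A ∪ B) ⟨0, hn⟩ hN) _) h1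
  rw [mul_one_div, ENNReal.div_le_iff (by simp) (by simp)] at h2
  rw [← ENNReal.ofReal_le_ofReal_iff (by positivity), mul_comm 2 ε,
    ENNReal.ofReal_mul hε]
  simpa using h2

end Propagation

end DecVI

/-! ### Placing the chain on the network -/

namespace DecVI

/-- On `p + 1` layers there are two disjoint groups of `r` nodes, separated by `max 1 (p + 2 - 2
r)` communication rounds; the function `h` bounds the distance from the first group. -/
lemma exists_groups (p r : ℕ) (χ : ℝ) (hr : r ≤ p + 1) :
    ∃ (A B : Finset (Fin ((p + 1) * 3))) (h : Fin ((p + 1) * 3) → ℕ), Disjoint A B ∧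
      A.card = r ∧ B.card = r ∧ (∀ m ∈ A, h m = 0) ∧ (∀ m ∈ B, h m = max 1 (p + 2 - 2 * r)) ∧
      ∀ i j, (supportGraph (layerGossip p χ) layerGossip_isSymm).Adj i j → h i ≤ h j + 1 := by
  classical
  set A : Finset (Fin ((p + 1) * 3)) :=
    Finset.univ.image fun j : Fin r => finProdFinEquiv (Fin.castLE hr j, (0 : Fin 3)) with hA
  set B : Finset (Fin ((p + 1) * 3)) :=
    Finset.univ.image fun j : Fin r => finProdFinEquiv ((Fin.castLE hr j).rev, (1 : Fin 3)) with hB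
  have hAB : Disjoint A B := by
    rw [Finset.disjoint_left]
    intro m hmA hmB
    obtain ⟨i, -, rfl⟩ := Finset.mem_image.1 hmA
    obtain ⟨j, -, hj⟩ := Finset.mem_image.1 hmB
    have := congrArg Prod.snd (finProdFinEquiv.injective hj)
    simp at this
  have hcA : A.card = r := by
    rw [hA, Finset.card_image_of_injective, Finset.card_univ, Fintype.card_fin]
    intro i j hij
    have := congrArg Prod.fst (finProdFinEquiv.injective hij)
    simpa using this
  have hcB : B.card = r := by
    rw [hB, Finset.card_image_of_injective, Finset.card_univ, Fintype.card_fin]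
    intro i j hij
    have := congrArg Prod.fst (finProdFinEquiv.injective hij)
    simpa using this
  by_cases hp : p < 2 * r
  · refine ⟨A, B, fun m => if m ∈ B then 1 else 0, hAB, hcA, hcB, fun m hm => ?_, fun m hm => ?_,
      fun i j _ => ?_⟩
    · exact if_neg (Finset.disjoint_left.1 hAB hm)
    · simp only [hm, if_true]; omega
    · beta_reduce
      split_ifs <;> omega
  · refine ⟨A, B, fun m => min (p + 2 - 2 * r) (((finProdFinEquiv.symm m).1 : ℕ) - (r - 1)),
      hAB, hcA, hcB, fun m hm => ?_, fun m hm => ?_, fun i j hij => ?_⟩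
    · obtain ⟨i, -, rfl⟩ := Finset.mem_image.1 hm
      simp only [Equiv.symm_apply_apply]
      have := i.2
      rw [Fin.val_castLE]
      omega
    · obtain ⟨i, -, rfl⟩ := Finset.mem_image.1 hm
      simp only [Equiv.symm_apply_apply]
      have := i.2
      rw [Fin.val_rev, Fin.val_castLE]
      omega
    · have := layerGossip_support hij.2
      simp only
      omega

lemma exists_layers {χ : ℝ} (hχ : 1 ≤ χ) :
    ∃ p : ℕ, (p = 0 ∨ 4 * (p + 1 : ℝ) ^ 2 ≤ χ) ∧ √χ ≤ 4 * (p + 1 : ℝ) := by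
  have hs : 1 ≤ √χ := Real.one_le_sqrt.2 hχ
  have h0 : 0 < ⌈√χ / 4⌉₊ := Nat.ceil_pos.2 (by linarith)
  obtain ⟨p, hp⟩ : ∃ p, ⌈√χ / 4⌉₊ = p + 1 := ⟨⌈√χ / 4⌉₊ - 1, by omega⟩
  have h1 : √χ / 4 ≤ (p + 1 : ℝ) := by
    have := Nat.le_ceil (√χ / 4)
    rw [hp] at this
    exact_mod_cast this
  refine ⟨p, ?_, by linarith⟩
  rcases Nat.eq_zero_or_pos p with h | h
  · exact .inl h
  · right
    have h2 : (p : ℝ) < √χ / 4 := Nat.lt_ceil.1 (by omega)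
    have h3 : (1 : ℝ) ≤ p := by exact_mod_cast h
    have h4 : √χ ^ 2 = χ := Real.sq_sqrt (by linarith)
    have h5 : 2 * (p + 1 : ℝ) ≤ √χ := by linarith
    nlinarith

/-- The decay rate of the solution: a ratio `q` with `1 / q - q = ρ` satisfies `-log (q²) ≤ ρ`. -/
lemma exists_ratio {ρ : ℝ} (hρ : 0 < ρ) :
    ∃ q : ℝ, 0 < q ∧ q < 1 ∧ 1 - q ^ 2 = ρ * q ∧ -Real.log (q ^ 2) ≤ ρ := by
  set s := Real.arsinh (ρ / 2) with hs
  have hsinh : Real.sinh s = ρ / 2 := Real.sinh_arsinh _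
  have hs0 : 0 < s := Real.arsinh_pos_iff.2 (by linarith)
  refine ⟨Real.exp (-s), Real.exp_pos _, by simpa using hs0, ?_, ?_⟩
  · have h1 : Real.exp s * Real.exp (-s) = 1 := by rw [← Real.exp_add]; simp
    rw [Real.sinh_eq] at hsinh
    have h2 : ρ = Real.exp s - Real.exp (-s) := by linarith
    rw [h2, sub_mul, h1]; ring
  · rw [Real.log_pow, Real.log_exp]
    have := Real.self_le_sinh_iff.2 hs0.le
    push_cast
    linarith

lemma le_of_pow_le {x R₀ ε ρ : ℝ} {k : ℕ} (hx : 0 < x) (hxρ : -Real.log x ≤ ρ) (hR : 0 < R₀)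
    (hε : 0 < ε) (h : R₀ ^ 2 * x ^ k ≤ 3 * ε) : Real.log (R₀ ^ 2 / ε) - 2 ≤ k * ρ := by
  have h1 : Real.log (R₀ ^ 2 * x ^ k) ≤ Real.log (3 * ε) :=
    Real.log_le_log (by positivity) h
  rw [Real.log_mul (by positivity) (by positivity), Real.log_pow x,
    Real.log_mul (by norm_num) hε.ne'] at h1
  rw [Real.log_div (by positivity) hε.ne']
  have h3 : Real.log 3 ≤ 2 := by
    have := Real.log_le_sub_one_of_pos (by norm_num : (0 : ℝ) < 3)
    linarith
  have h4 : (k : ℝ) * -Real.log x ≤ k * ρ := by gcongr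
  linarith

lemma stronglyMonotone_op {M n d : ℕ} {Q : Problem M n d} {ν : ℝ}
    (h : ∀ m, StronglyMonotone (Q.localOp m) ν) : StronglyMonotone Q.op (M * ν) := by
  intro u v
  simp only [Problem.op]
  rw [← Finset.sum_sub_distrib, sum_inner]
  calc (M : ℝ) * ν * ‖u - v‖ ^ 2 = ∑ _m : Fin M, ν * ‖u - v‖ ^ 2 := by simp; ring
    _ ≤ _ := Finset.sum_le_sum fun m _ => h m u v

/-- The hard instance, with its two lower bounds for a given procedure: if `ρ` is the ratio of the
monotonicity to the coupling strength of the global operator, then the solution decays so slowly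
that about `log (R₀² / ε) / ρ` coordinates have to be found, at the cost of `Δ` rounds and `n`
local computations each. -/
lemma exists_chain_instance {M : ℕ} (G : SimpleGraph (Fin M)) {A B : Finset (Fin M)} {r : ℕ}
    (hAB : Disjoint A B) (hA : A.card = r) (hB : B.card = r) (hr : 0 < r) {h : Fin M → ℕ} {Δ : ℕ}
    (hΔ : 0 < Δ) (hhA : ∀ m ∈ A, h m = 0) (hhB : ∀ m ∈ B, h m = Δ)
    (hG : ∀ i j, G.Adj i j → h i ≤ h j + 1) {n : ℕ} (hn : 1 ≤ n) {ν β L Lbar R₀ ε ρ : ℝ}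
    (hν : 0 < ν) (hβ : 0 < β) (hL : 0 ≤ L) (hLbar : Lbar ^ 2 = n * L ^ 2)
    (hνβ : ν ^ 2 + β ^ 2 ≤ L ^ 2) (hR : 0 < R₀) (hε : 0 < ε) (hρ : ρ = M * ν / (r * β))
    (hlog : 4 + 4 * ρ ≤ Real.log (R₀ ^ 2 / ε)) :
    ∃ d₀ : ℕ, ∀ d : ℕ, d₀ ≤ d → ∃ (Q : Problem M n d) (zs : Vec d),
      Q.IsLipschitz L Lbar ∧ (∀ m, StronglyMonotone (Q.localOp m) ν) ∧ Q.IsSolution zs ∧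
      ‖zs‖ = R₀ ∧ ∀ (Ω : Type) (_ : MeasurableSpace Ω) (P : Measure Ω) (_ : IsProbabilityMeasure P)
        (R : Procedure Q G P), R.IsEpsSolution zs ε →
        (∀ K : ℕ, (∀ᵐ ω ∂P, R.rounds ω ≤ K) → Δ * Real.log (R₀ ^ 2 / ε) ≤ 2 * ρ * K) ∧
        (∀ N : ℕ, (∀ᵐ ω ∂P, ∑ m ∈ A ∪ B, R.calls m ω ≤ N) →
          n * Real.log (R₀ ^ 2 / ε) ≤ 4 * ρ * N) := by
  have hr0 : (0 : ℝ) < r := by exact_mod_cast hr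
  have hMr : 2 * r ≤ M := by
    have h1 := Finset.card_union_of_disjoint hAB
    have h2 := Finset.card_le_univ (A ∪ B)
    rw [Fintype.card_fin] at h2
    omega
  have hMr' : 2 * (r : ℝ) ≤ M := by exact_mod_cast hMr
  have hM0 : (0 : ℝ) < M := by linarith
  have hρ0 : 0 < ρ := by rw [hρ]; positivity
  obtain ⟨q, hq0, hq1, hqρ, hqlog⟩ := exists_ratio hρ0
  have hq : r * β * (1 - q ^ 2) = M * ν * q := by
    rw [hqρ, hρ]; field_simp
  have hend : 2 * ν * q * β ≤ β ^ 2 * (1 - q ^ 2) := by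
    refine le_of_mul_le_mul_left ?_ hr0
    calc (r : ℝ) * (2 * ν * q * β) = (2 * r) * (ν * q * β) := by ring
      _ ≤ M * (ν * q * β) := by gcongr
      _ = r * (β ^ 2 * (1 - q ^ 2)) := by linear_combination -β * hq
  have hx0 : 0 < q ^ 2 := by positivity
  have hx1 : q ^ 2 < 1 := by nlinarith
  obtain ⟨d₀, hd₀⟩ : ∃ d₀ : ℕ, ∀ d ≥ d₀, (q ^ 2) ^ d ≤ ε / R₀ ^ 2 :=
    Filter.eventually_atTop.1 ((tendsto_pow_atTop_nhds_zero_of_lt_one hx0.le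
      hx1).eventually_le_const (by positivity))
  refine ⟨d₀ + 1, fun d hd => ?_⟩
  have hd0 : 0 < d := by omega
  have hdε : R₀ ^ 2 * (q ^ 2) ^ d ≤ ε := by
    have := hd₀ d (by omega)
    rwa [le_div_iff₀ (by positivity), mul_comm] at this
  set S := ∑ k ∈ Finset.range d, (q ^ 2) ^ k with hS
  have hS0 : 0 < S := Finset.sum_pos (fun _ _ => by positivity) ⟨0, by simpa using hd0⟩
  set C := R₀ / √S with hC
  have hnorm : ‖geomVec d C q‖ = R₀ := by
    rw [← sq_eq_sq₀ (norm_nonneg _) hR.le, norm_geomVec_sq, ← hS, hC, div_pow,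
      Real.sq_sqrt hS0.le, div_mul_cancel₀ _ hS0.ne']
  refine ⟨chainProblem A B n d ν β q (C * β / q), geomVec d C q,
    chainProblem_isLipschitz hn hL hLbar hνβ hend, fun m => ?_,
    chainProblem_isSolution hn hd0 hAB hA hB hq (div_mul_cancel₀ _ hq0.ne') hq0.ne', hnorm, ?_⟩
  · intro u v
    rw [chainProblem_localOp hn, chainProblem_localOp hn]
    exact workerOp_stronglyMonotone hβ.le hq0.le m u v
  intro Ω _ P _ R hRε
  refine ⟨fun K hK => ?_, fun N hN => ?_⟩
  · have h1 := R.error_ge_of_rounds hAB hε.le hΔ hhA hhB hG hq0.le hq1 hK hRε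
    rw [hnorm, mul_sub] at h1
    have h2 := le_of_pow_le hx0 hqlog hR hε (k := K / Δ + 2) (by linarith)
    push_cast at h2
    have h3 : (Δ : ℝ) * ((K / Δ : ℕ) : ℝ) ≤ K := by exact_mod_cast Nat.mul_div_le K Δ
    have h4 : Real.log (R₀ ^ 2 / ε) / 2 ≤ ((K / Δ : ℕ) : ℝ) * ρ := by linarith
    have hΔ0 : (0 : ℝ) < Δ := by exact_mod_cast hΔ
    nlinarith [mul_le_mul_of_nonneg_left h4 hΔ0.le, mul_le_mul_of_nonneg_right h3 hρ0.le]
  · have h1 := R.error_ge_of_calls hn hε.le hq0.le hq1 hN hRε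
    rw [hnorm, mul_sub] at h1
    have h2 := le_of_pow_le hx0 hqlog hR hε (k := 2 * N / n + 1) (by linarith)
    push_cast at h2
    have h3 : (n : ℝ) * ((2 * N / n : ℕ) : ℝ) ≤ 2 * N := by exact_mod_cast Nat.mul_div_le (2 * N) n
    have h4 : Real.log (R₀ ^ 2 / ε) / 2 ≤ ((2 * N / n : ℕ) : ℝ) * ρ := by linarith
    have hn0 : (0 : ℝ) < n := by exact_mod_cast hn
    nlinarith [mul_le_mul_of_nonneg_left h4 hn0.le, mul_le_mul_of_nonneg_right h3 hρ0.le]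

/-- The hard instance on the layered network. The bound `ρ ≤ a μ / L` on the inverse condition
number of the global operator turns into complexity bounds with a constant depending on `a` only.
-/
lemma exists_layered_instance {p r n : ℕ} {μ ν β L Lbar χ R₀ ε a : ℝ} (hr : 0 < r) (hrp : r ≤ p + 1)
    (hn : 1 ≤ n) (hμ : 0 < μ) (hν : 0 < ν) (hβ : 0 < β) (hLμ : μ ≤ L)
    (hL : L = Lbar / √(n : ℝ)) (hνβ : ν ^ 2 + β ^ 2 ≤ L ^ 2) (hR : 0 < R₀) (hε : 0 < ε) (ha : 0 < a)
    (hρ : (((p + 1) * 3 : ℕ) : ℝ) * ν / (r * β) ≤ a * (μ / L))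
    (hδ : ε ≤ Real.exp (-(4 + 4 * a)) * R₀ ^ 2) :
    ∃ d₀ : ℕ, ∀ d : ℕ, d₀ ≤ d → ∃ (Q : Problem ((p + 1) * 3) n d) (zs : Vec d),
      Q.IsLipschitz L Lbar ∧ (∀ m, StronglyMonotone (Q.localOp m) ν) ∧ Q.IsSolution zs ∧
      zs ≠ 0 ∧ ‖0 - zs‖ = R₀ ∧ ∀ K N : ℕ,
        SolvableTotal Q (supportGraph (layerGossip p χ) layerGossip_isSymm) zs K N ε ∨
          r = 1 ∧ SolvablePerDevice Q (supportGraph (layerGossip p χ) layerGossip_isSymm) zs K N ε →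
        (√χ ≤ 16 * ((max 1 (p + 2 - 2 * r) : ℕ) : ℝ) →
          1 / (64 * a) * (√χ * (1 + L / μ) * Real.log (R₀ ^ 2 / ε)) ≤ K) ∧
        1 / (64 * a) * ((n + √(n : ℝ) * (Lbar / μ)) * Real.log (R₀ ^ 2 / ε)) ≤ N := by
  have hL0 : 0 < L := hμ.trans_le hLμ
  have hn0 : (0 : ℝ) < n := by exact_mod_cast hn
  have hsn : √(n : ℝ) ^ 2 = n := Real.sq_sqrt hn0.le
  have hsn0 : 0 < √(n : ℝ) := Real.sqrt_pos.2 hn0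
  have hLb : Lbar = √(n : ℝ) * L := by rw [hL]; field_simp
  have hμL : μ / L ≤ 1 := by rw [div_le_one hL0]; exact hLμ
  set ρ := (((p + 1) * 3 : ℕ) : ℝ) * ν / (r * β) with hρd
  have hρa : ρ ≤ a := hρ.trans (mul_le_of_le_one_right ha.le hμL)
  set Λ := Real.log (R₀ ^ 2 / ε) with hΛ
  have hlog : 4 + 4 * a ≤ Λ := by
    rw [hΛ, Real.le_log_iff_exp_le (by positivity), le_div_iff₀ hε]
    calc Real.exp (4 + 4 * a) * ε ≤ Real.exp (4 + 4 * a) * (Real.exp (-(4 + 4 * a)) * R₀ ^ 2) := by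
          gcongr
      _ = R₀ ^ 2 := by rw [← mul_assoc, ← Real.exp_add]; simp
  have hΛ0 : 0 ≤ Λ := by linarith
  obtain ⟨A, B, h, hAB, hA, hB, hhA, hhB, hG⟩ := exists_groups p r χ hrp
  obtain ⟨d₀, hd₀⟩ := exists_chain_instance _ hAB hA hB hr (by omega) hhA hhB hG hn hν hβ hL0.le
    (Lbar := Lbar) (by rw [hLb, mul_pow, hsn]) hνβ hR hε hρd (by linarith)
  refine ⟨d₀, fun d hd => ?_⟩
  obtain ⟨Q, zs, hQ, hmon, hsol, hzs, hproc⟩ := hd₀ d hd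
  refine ⟨Q, zs, hQ, hmon, hsol, fun h0 => ?_, by rwa [zero_sub, norm_neg], fun K N hKN => ?_⟩
  · rw [h0, norm_zero] at hzs; exact hR.ne hzs
  -- The per-device count over the two active devices of the case `r = 1` is at most `2 N`.
  obtain ⟨h1, h2⟩ : (((max 1 (p + 2 - 2 * r) : ℕ) : ℝ) * Λ ≤ 2 * ρ * K) ∧
      (n * Λ ≤ 4 * ρ * ((2 * N : ℕ) : ℝ)) := by
    rcases hKN with ⟨Ω, _, P, hP, R, hK, hN, hRε⟩ | ⟨rfl, Ω, _, P, hP, R, hK, hN, hRε⟩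
    · refine ⟨(hproc Ω _ P hP R hRε).1 K hK, (hproc Ω _ P hP R hRε).2 (2 * N) ?_⟩
      filter_upwards [hN] with ω hω
      have := Finset.sum_le_sum_of_subset (f := fun m => R.calls m ω) (Finset.subset_univ (A ∪ B))
      omega
    · refine ⟨(hproc Ω _ P hP R hRε).1 K hK, (hproc Ω _ P hP R hRε).2 (2 * N) ?_⟩
      filter_upwards [hN] with ω hω
      refine (Finset.sum_le_card_nsmul _ _ N fun m _ => hω m).trans ?_
      rw [Finset.card_union_of_disjoint hAB, hA, hB, smul_eq_mul]
  have hcond : 1 + L / μ ≤ 2 * (L / μ) := by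
    have : 1 ≤ L / μ := by rw [le_div_iff₀ hμ]; linarith
    linarith
  have hinv : μ / L * (L / μ) = 1 := by field_simp
  have hLμ0 : 0 < L / μ := by positivity
  have hρL : ρ * (L / μ) ≤ a := by
    calc ρ * (L / μ) ≤ a * (μ / L) * (L / μ) := by gcongr
      _ = a := by rw [mul_assoc, hinv, mul_one]
  refine ⟨fun hχΔ => ?_, ?_⟩
  · rw [div_mul_eq_mul_div, one_mul, div_le_iff₀ (by positivity)]
    calc √χ * (1 + L / μ) * Λ
        ≤ 16 * ((max 1 (p + 2 - 2 * r) : ℕ) : ℝ) * (2 * (L / μ)) * Λ := by gcongr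
      _ = 32 * (L / μ) * (((max 1 (p + 2 - 2 * r) : ℕ) : ℝ) * Λ) := by ring
      _ ≤ 32 * (L / μ) * (2 * ρ * K) := by gcongr
      _ = 64 * (ρ * (L / μ)) * K := by ring
      _ ≤ 64 * a * K := by gcongr
      _ = K * (64 * a) := by ring
  · rw [div_mul_eq_mul_div, one_mul, div_le_iff₀ (by positivity)]
    have e : n + √(n : ℝ) * (Lbar / μ) = n * (1 + L / μ) := by
      rw [hLb]; linear_combination (L / μ) * hsn
    calc (n + √(n : ℝ) * (Lbar / μ)) * Λ = n * (1 + L / μ) * Λ := by rw [e]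
      _ ≤ n * (2 * (L / μ)) * Λ := by gcongr
      _ = 2 * (L / μ) * (n * Λ) := by ring
      _ ≤ 2 * (L / μ) * (4 * ρ * ((2 * N : ℕ) : ℝ)) := by gcongr
      _ = 16 * (ρ * (L / μ)) * N := by push_cast; ring
      _ ≤ 16 * a * N := by gcongr
      _ ≤ 64 * a * N := by gcongr; norm_num
      _ = N * (64 * a) := by ring

end DecVI

theorem corollary1 :
    -- every local operator is `μ`-strongly monotone
    (∀ κ : ℝ, 1 < κ → ∃ c δ : ℝ, 0 < c ∧ 0 < δ ∧
      ∀ (n : ℕ) (μ Lbar L χ R₀ ε : ℝ), 1 ≤ n → 0 < μ → L = Lbar / √(n : ℝ) → κ * μ ≤ L → 1 ≤ χ →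
        0 < R₀ → 0 < ε → ε ≤ δ * R₀ ^ 2 → ∃ d₀ : ℕ, ∀ d : ℕ, d₀ ≤ d →
        -- one instance for both bounds, local computations counted over all devices
        (∃ (M : ℕ) (G : SimpleGraph (Fin M)) (W : Matrix (Fin M) (Fin M) ℝ)
            (Q : DecVI.Problem M n d) (zs : DecVI.Vec d),
          DecVI.IsFixedNetwork G W χ ∧ Q.IsLipschitz L Lbar ∧
          (∀ m, DecVI.StronglyMonotone (Q.localOp m) μ) ∧
          Q.IsSolution zs ∧ zs ≠ 0 ∧ ‖0 - zs‖ = R₀ ∧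
          ∀ K N : ℕ, DecVI.SolvableTotal Q G zs K N ε →
            c * (√χ * (1 + L / μ) * Real.log (R₀ ^ 2 / ε)) ≤ K ∧
            c * ((n + √(n : ℝ) * (Lbar / μ)) * Real.log (R₀ ^ 2 / ε)) ≤ N) ∧
        -- local computations counted on each device
        (∃ (M : ℕ) (G : SimpleGraph (Fin M)) (W : Matrix (Fin M) (Fin M) ℝ)
            (Q : DecVI.Problem M n d) (zs : DecVI.Vec d),
          DecVI.IsFixedNetwork G W χ ∧ Q.IsLipschitz L Lbar ∧
          (∀ m, DecVI.StronglyMonotone (Q.localOp m) μ) ∧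
          Q.IsSolution zs ∧ zs ≠ 0 ∧ ‖0 - zs‖ = R₀ ∧
          ∀ K N : ℕ, DecVI.SolvablePerDevice Q G zs K N ε →
            c * ((n + √(n : ℝ) * (Lbar / μ)) * Real.log (R₀ ^ 2 / ε)) ≤ N)) ∧
    -- the sum of the local operators is `μ`-strongly monotone: one instance for both bounds,
    -- local computations counted on each device
    (∃ c δ : ℝ, 0 < c ∧ 0 < δ ∧
      ∀ (n : ℕ) (μ Lbar L χ R₀ ε : ℝ), 1 ≤ n → 0 < μ → L = Lbar / √(n : ℝ) → μ ≤ L → 1 ≤ χ →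
        0 < R₀ → 0 < ε → ε ≤ δ * R₀ ^ 2 → ∃ d₀ : ℕ, ∀ d : ℕ, d₀ ≤ d →
        ∃ (M : ℕ) (G : SimpleGraph (Fin M)) (W : Matrix (Fin M) (Fin M) ℝ)
            (Q : DecVI.Problem M n d) (zs : DecVI.Vec d),
          DecVI.IsFixedNetwork G W χ ∧ Q.IsLipschitz L Lbar ∧
          DecVI.StronglyMonotone Q.op μ ∧
          (∀ m, DecVI.StronglyMonotone (Q.localOp m) (μ / M)) ∧
          Q.IsSolution zs ∧ zs ≠ 0 ∧ ‖0 - zs‖ = R₀ ∧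
          ∀ K N : ℕ, DecVI.SolvablePerDevice Q G zs K N ε →
            c * (√χ * (1 + L / μ) * Real.log (R₀ ^ 2 / ε)) ≤ K ∧
            c * ((n + √(n : ℝ) * (Lbar / μ)) * Real.log (R₀ ^ 2 / ε)) ≤ N) := by
  constructor
  · intro κ hκ
    have hκ2 : 1 < κ ^ 2 := by nlinarith
    have hθ2 : 0 < 1 - 1 / κ ^ 2 := by
      rw [sub_pos, div_lt_one (by positivity)]; exact hκ2
    set θ := √(1 - 1 / κ ^ 2) with hθ
    have hθ0 : 0 < θ := Real.sqrt_pos.2 hθ2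
    have hθsq : θ ^ 2 = 1 - 1 / κ ^ 2 := Real.sq_sqrt hθ2.le
    refine ⟨1 / (64 * (9 / θ)), Real.exp (-(4 + 4 * (9 / θ))), by positivity, Real.exp_pos _, ?_⟩
    intro n μ Lbar L χ R₀ ε hn hμ hL hκL hχ hR hε hδ
    have hμL : μ ≤ L := by nlinarith
    have hL0 : 0 < L := by linarith
    obtain ⟨p, hp, hpχ⟩ := DecVI.exists_layers hχ
    have hνβ : μ ^ 2 + (θ * L) ^ 2 ≤ L ^ 2 := by
      have h1 : μ ^ 2 ≤ (1 / κ ^ 2) * L ^ 2 := by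
        rw [div_mul_eq_mul_div, one_mul, le_div_iff₀ (by positivity), ← mul_pow]
        exact pow_le_pow_left₀ (by positivity) (by linarith) 2
      rw [mul_pow, hθsq]; linarith
    -- The groups contain a ninth of all nodes, so the condition number is at least `θ L / (9 μ)`.
    have hρ : ∀ p r : ℕ, 0 < r → (p + 1) * 3 ≤ 9 * r →
        (((p + 1) * 3 : ℕ) : ℝ) * μ / (r * (θ * L)) ≤ 9 / θ * (μ / L) := by
      intro p r hr hpr
      have hr0 : (0 : ℝ) < r := by exact_mod_cast hr
      have h1 : (((p + 1) * 3 : ℕ) : ℝ) ≤ 9 * r := by exact_mod_cast hpr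
      rw [div_mul_div_comm, div_le_div_iff₀ (by positivity) (by positivity)]
      calc (((p + 1) * 3 : ℕ) : ℝ) * μ * (θ * L) ≤ 9 * r * μ * (θ * L) := by gcongr
        _ = _ := by ring
    obtain ⟨d₁, h₁⟩ := DecVI.exists_layered_instance (p := p) (r := (p + 3) / 3) (by omega)
      (by omega) hn hμ hμ (by positivity : 0 < θ * L) hμL hL hνβ hR hε (by positivity)
      (hρ _ _ (by omega) (by omega)) hδ
    obtain ⟨d₂, h₂⟩ := DecVI.exists_layered_instance (p := 0) (r := 1) (by omega)
      (by omega) hn hμ hμ (by positivity : 0 < θ * L) hμL hL hνβ hR hε (by positivity)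
      (hρ _ _ (by omega) (by omega)) hδ
    refine ⟨max d₁ d₂, fun d hd => ⟨?_, ?_⟩⟩
    · obtain ⟨Q, zs, hQ, hmon, hsol, hzs, hnorm, hb⟩ := h₁ d ((le_max_left _ _).trans hd)
      refine ⟨_, _, _, Q, zs, DecVI.isFixedNetwork_layerGossip hχ hp, hQ, hmon, hsol, hzs, hnorm,
        fun K N hKN => ?_⟩
      have hb' := hb K N (.inl hKN)
      refine ⟨hb'.1 (hpχ.trans ?_), hb'.2⟩
      have : p + 1 ≤ 4 * max 1 (p + 2 - 2 * ((p + 3) / 3)) := by omega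
      have : (p + 1 : ℝ) ≤ 4 * ((max 1 (p + 2 - 2 * ((p + 3) / 3)) : ℕ) : ℝ) := by
        exact_mod_cast this
      linarith
    · obtain ⟨Q, zs, hQ, hmon, hsol, hzs, hnorm, hb⟩ := h₂ d ((le_max_right _ _).trans hd)
      exact ⟨_, _, _, Q, zs, DecVI.isFixedNetwork_layerGossip hχ (.inl rfl), hQ, hmon, hsol, hzs,
        hnorm, fun K N hKN => (hb K N (.inr ⟨rfl, hKN⟩)).2⟩
  · refine ⟨1 / (64 * 2), Real.exp (-(4 + 4 * 2)), by norm_num, Real.exp_pos _, ?_⟩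
    intro n μ Lbar L χ R₀ ε hn hμ hL hμL hχ hR hε hδ
    have hL0 : 0 < L := by linarith
    obtain ⟨p, hp, hpχ⟩ := DecVI.exists_layers hχ
    set M := (p + 1) * 3 with hM
    have hM3 : (3 : ℝ) ≤ M := by exact_mod_cast (by omega : 3 ≤ M)
    have hνL : μ / M ≤ L / 2 := by
      rw [div_le_div_iff₀ (by linarith) (by norm_num)]
      nlinarith
    have hν0 : 0 < μ / M := by positivity
    obtain ⟨d₀, h₀⟩ := DecVI.exists_layered_instance (p := p) (r := 1) (ν := μ / M) (β := L / 2)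
      (a := 2) (by omega) (by omega) hn hμ hν0 (by positivity) hμL hL (by nlinarith) hR hε
      (by norm_num) (by rw [← hM]; apply le_of_eq; push_cast; field_simp) hδ
    refine ⟨d₀, fun d hd => ?_⟩
    obtain ⟨Q, zs, hQ, hmon, hsol, hzs, hnorm, hb⟩ := h₀ d hd
    refine ⟨_, _, _, Q, zs, DecVI.isFixedNetwork_layerGossip hχ hp, hQ, ?_, hmon, hsol, hzs, hnorm,
      fun K N hKN => ?_⟩
    · have := DecVI.stronglyMonotone_op hmon
      rwa [mul_div_cancel₀ μ (by positivity)] at this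
    · have hb' := hb K N (.inr ⟨rfl, hKN⟩)
      refine ⟨hb'.1 (hpχ.trans ?_), hb'.2⟩
      have : p + 1 ≤ 4 * max 1 (p + 2 - 2 * 1) := by omega
      have : (p + 1 : ℝ) ≤ 4 * ((max 1 (p + 2 - 2 * 1) : ℕ) : ℝ) := by exact_mod_cast this
      linarith
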